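/- **Conventions.** A line arrangement is a finite ordered (indexed) family $\mathcal A$ of pairwise distinct lines of $\mathbb{CP}^2$. A singular point is identified with the set of all lines of $\mathcal A$ through it; the combinatorics $\mathcal C(\mathcal A)$ is the index set together with the set $\mathrm{Sing}(\mathcal A)$ of singular points. The moduli space $\mathcal M(\mathcal C)$ is the topological space of all ordered arrangements with combinatorics $\mathcal C$ modulo $\mathrm{PGL}_3(\mathbb C)$; $\mathcal A$ is *rigid* if the connected component of its class in $\mathcal M(\mathcal C(\mathcal A))$ has dimension $0$ (is a point). The definition field $\mathbb F(\mathcal A)\subset\mathbb C$ is generated over $\mathbb Q$ by the ratios of the coefficients of the lines. Two arrangements form a *pair* if they have the same combinatorics and lie in different connected components of its moduli space. A pair of arrangements defined over number fields is *arithmetic* if $\sigma\cdot\mathcal A_1=\mathcal A_2$ (line by line) for some number field $F\supset\mathbb F(\mathcal A_1),\mathbb F(\mathcal A_2)$ and some $\sigma\in\mathrm{Aut}(F/\mathbb Q)$, *nonarithmetic* otherwise; it is *rational* if $\mathbb F(\mathcal A_1)=\mathbb F(\mathcal A_2)=\mathbb Q$. A *plinth* $\Psi$ of length $r\ge 3$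 on $\mathcal C(\mathcal A)$ consists of lines $S_1,\dots,S_r$ of $\mathcal A$ and singular points $P_1,\dots,P_r$ of $\mathcal A$ with $S_i\notin P_i$ and $S_{i+1}\notin P_i$ (indices modulo $r$). A *splitting polygon* on $\Psi$ is a tuple of lines $(E_1,\dots,E_r)$ such that $E_i\cap E_{i+1}\cap S_{i+1}\ne\emptyset$, $E_i$ passes through $P_i$, and all the other intersections are generic: the lines of $\mathcal A\cup E$ are pairwise distinct, and the set of lines of $\mathcal A\cup E$ through any point of $E_i$ either has at most two elements, or is $\{S_{j+1},E_j,E_{j+1}\}$ for some $j$, or is $P_i\cup\{E_j : P_j=P_i\}$. Let $K\subset\mathbb C$ be a field containing $\mathbb F(\mathcal A)$, and choose coordinates in $K$ of the $S_i$ and $P_i$ and a linear parametrization $\lambda\mapsto Q_1^\lambda=u+\lambda v$ over $K$ of $S_1$. Let $E_i^\lambda$ be the line through $Q_i^\lambda$ and $P_i$, and $Q_{i+1}^\lambda=E_i^\lambda\cap S_{i+1}$, computed by cross products. Then $\Delta_\Psi\in K[\lambda]$ is the determinant of the coefficients of $S_1,E_1^\lambda,E_r^\lambda$; its degree is at most $2$.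 A polynomial is *reducible* over $K$ if it is nonzero and is a product of two polynomials of positive degree. **Theorem.** 1. (Nonarithmetic pairs.) Let $\mathcal A$ be a rigid arrangement whose definition field is a number field. Let $\Psi_1$ be a plinth of length $r_1$ on $\mathcal C(\mathcal A)$ such that $\Delta_{\Psi_1}$ has degree $2$ and is irreducible over $\mathbb F(\mathcal A)$, with complex roots $\mu_1\neq\mu_2$. If $r_1\ge 4$, assume also that $E^{\mu_1}$ or $E^{\mu_2}$ is a splitting polygon on $\Psi_1$. Put $\mathcal A^i=\mathcal A\cup E^{\mu_i}$. Then both $E^{\mu_1},E^{\mu_2}$ are splitting polygons on $\Psi_1$; $\mathcal A^1,\mathcal A^2$ form an arithmetic pair; both are rigid; and $\mathbb F(\mathcal A^1)=\mathbb F(\mathcal A^2)$ is a quadratic extension of $\mathbb F(\mathcal A)$. Moreover, let $i\in\{1,2\}$ and let $\Psi_2$ be a plinth on $\mathcal C(\mathcal A^i)$ such that $\Delta_{\Psi_2}$ is reducible over $\mathbb F(\mathcal A^i)$ and has two distinct roots $\nu_1\ne\nu_2$, with $E^{\nu_1}$ and $E^{\nu_2}$ both splitting polygons on $\Psi_2$.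 Then $\mathcal A^i\cup E^{\nu_1}$ and $\mathcal A^i\cup E^{\nu_2}$ form a nonarithmetic pair, and both have definition field $\mathbb F(\mathcal A^i)$. 2. (Rational pairs.) Let $\mathcal A$ be a rigid arrangement with $\mathbb F(\mathcal A)=\mathbb Q$, and let $\Psi$ be a plinth on $\mathcal C(\mathcal A)$ such that $\Delta_\Psi$ is reducible in $\mathbb Q[\lambda]$ and has two distinct roots $\nu_1\neq\nu_2$, with $E^{\nu_1}$ and $E^{\nu_2}$ both splitting polygons on $\Psi$. Then $\mathcal A\cup E^{\nu_1}$ and $\mathcal A\cup E^{\nu_2}$ form a rational pair. -/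

import Mathlib

open scoped LinearAlgebra.Projectivization MatrixGroups Matrix Polynomial

noncomputable section

namespace LineArr

/-! ### The projective plane and its dual -/

/-- Points and lines of the complex projective plane are both given by homogeneous coordinates:
the point `(x : y : z)` lies on the line `[a : b : c]` when `a x + b y + c z = 0`. -/
abbrev Point : Type := ℙ ℂ (Fin 3 → ℂ)

/-- Lines, i.e. points of the dual projective plane. -/
abbrev Line : Type := ℙ ℂ (Fin 3 → ℂ)

/-- The classical topology of the (dual) projective plane: the quotient topology of the space of
nonzero vectors. -/
instance projTopology : TopologicalSpace (ℙ ℂ (Fin 3 → ℂ)) :=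
  TopologicalSpace.coinduced (Projectivization.mk' ℂ : {v : Fin 3 → ℂ // v ≠ 0} → _) inferInstance

/-- The point `x` lies on the line `L`. -/
def OnLine (x : Point) (L : Line) : Prop := Projectivization.orthogonal x L

/-! ### Arrangements, combinatorics and moduli spaces

A line arrangement is a finite family of pairwise distinct lines, indexed by `ι`. -/

section Arrangement

variable {ι : Type*}

/-- The set of (indices of) lines of the family `A` which pass through the point `x`. -/
def linesThrough (A : ι → Line) (x : Point) : Set ι := {i | OnLine x (A i)}

/-- The singular points of `A`, each one given as the set of all the lines of `A` through it.
The combinatorics of `A` is the pair `(ι, sing A)`. -/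
def sing (A : ι → Line) : Set (Set ι) :=
  {P | P.Nontrivial ∧ ∃ x : Point, P = linesThrough A x}

/-- All the arrangements with combinatorics `(ι, C)`. -/
def Realization (C : Set (Set ι)) : Type _ :=
  {A : ι → Line // Function.Injective A ∧ sing A = C}

instance (C : Set (Set ι)) : TopologicalSpace (Realization C) :=
  inferInstanceAs (TopologicalSpace {A : ι → Line // Function.Injective A ∧ sing A = C})

/-- Projective equivalence. As `A` is a family of points in the dual plane, a projective
transformation of the plane acts on it through its inverse transpose, and the latter runs over
all of `PGL₃(ℂ)`. -/
instance projEquiv (C : Set (Set ι)) : Setoid (Realization C) where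
  r A B := ∃ g : PGL(Fin 3, ℂ), ∀ i, g • A.1 i = B.1 i
  iseqv :=
    { refl := fun _ => ⟨1, fun _ => one_smul _ _⟩
      symm := fun ⟨g, hg⟩ => ⟨g⁻¹, fun i => by rw [← hg i, inv_smul_smul]⟩
      trans := fun ⟨g, hg⟩ ⟨h, hh⟩ => ⟨h * g, fun i => by rw [mul_smul, hg i, hh i]⟩ }

/-- The moduli space of the combinatorics `(ι, C)`, with the quotient topology. -/
abbrev Moduli (C : Set (Set ι)) : Type _ := Quotient (projEquiv C)

/-- The class in the moduli space. -/
def Realization.cls {C : Set (Set ι)} (A : Realization C) : Moduli C := Quotient.mk _ A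

/-- `A` is a rigid arrangement: the connected component of its class in the moduli space of its
combinatorics has dimension `0`, i.e. it is a single point. -/
def IsRigid (A : ι → Line) : Prop :=
  ∃ a : Realization (sing A), a.1 = A ∧ connectedComponent a.cls = {a.cls}

/-- `A` and `B` form a pair: they are arrangements with the same combinatorics which lie in
different connected components of the moduli space of this combinatorics. -/
def IsPair (A B : ι → Line) : Prop :=
  ∃ (C : Set (Set ι)) (a b : Realization C), a.1 = A ∧ b.1 = B ∧
    connectedComponent a.cls ≠ connectedComponent b.cls

end Arrangement

/-! ### Definition fields and Galois conjugation -/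

section Fields

variable {ι : Type*} {K : Type*} [Field K] [Algebra K ℂ]

/-- A vector over a field `K`, seen as a vector over `ℂ`. -/
def toC (a : Fin 3 → K) : Fin 3 → ℂ := fun j => algebraMap K ℂ (a j)

/-- `a` is a vector of homogeneous coordinates, in `K`, of the point or line `L`. -/
def IsCoord (a : Fin 3 → K) (L : ℙ ℂ (Fin 3 → ℂ)) : Prop :=
  ∃ h : toC a ≠ 0, L = Projectivization.mk ℂ (toC a) h

/-- The definition field of `A`: the subfield of `ℂ` generated by the coefficients of the lines.
Since the equation of a line is determined up to a scalar only, these are the ratios of its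
coefficients. -/
def defField (A : ι → Line) : IntermediateField ℚ ℂ :=
  IntermediateField.adjoin ℚ
    {z : ℂ | ∃ (i : ι) (a : Fin 3 → ℂ) (j k : Fin 3), IsCoord a (A i) ∧ a j ≠ 0 ∧ z = a k / a j}

/-- `B = σ · A`, line by line, for an automorphism `σ` of a subfield `F` of `ℂ` over which `A`
is defined. -/
def IsConj (F : IntermediateField ℚ ℂ) (σ : F ≃ₐ[ℚ] F) (A B : ι → Line) : Prop :=
  ∀ i, ∃ a : Fin 3 → F, IsCoord a (A i) ∧ IsCoord (fun j => σ (a j)) (B i)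

/-- `A` and `B` are Galois conjugate: `σ · A = B` for an automorphism `σ` of some number field
containing the definition fields of both. -/
def GaloisConjugate (A B : ι → Line) : Prop :=
  ∃ F : IntermediateField ℚ ℂ, NumberField F ∧ defField A ≤ F ∧ defField B ≤ F ∧
    ∃ σ : F ≃ₐ[ℚ] F, IsConj F σ A B

/-- Arithmetic pairs. -/
def IsArithmeticPair (A B : ι → Line) : Prop :=
  IsPair A B ∧ GaloisConjugate A B

/-- Nonarithmetic pairs (of arrangements defined over number fields). -/
def IsNonarithmeticPair (A B : ι → Line) : Prop :=
  IsPair A B ∧ NumberField (defField A) ∧ NumberField (defField B) ∧ ¬ GaloisConjugate A B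

/-- Rational pairs. -/
def IsRationalPair (A B : ι → Line) : Prop :=
  IsPair A B ∧ defField A = ⊥ ∧ defField B = ⊥

end Fields

/-! ### Plinths and splitting polygons -/

section Plinths

variable {ι : Type*} {r : ℕ} [NeZero r]

/-- A plinth of length `r ≥ 3` on the combinatorics `(ι, C)`. Indices are taken modulo `r`
(and start at `0`). -/
structure Plinth (C : Set (Set ι)) (r : ℕ) [NeZero r] where
  three_le : 3 ≤ r
  support : Fin r → ι
  pivot : Fin r → Set ι
  pivot_mem : ∀ i, pivot i ∈ C
  support_notMem : ∀ i, support i ∉ pivot i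
  support_succ_notMem : ∀ i, support (i + 1) ∉ pivot i

/-- The family of lines obtained by adding the lines `E` to `A`. -/
def addLines (A : ι → Line) (E : Fin r → Line) : ι ⊕ Fin r → Line := Sum.elim A E

/-- The set of lines of `A ∪ E` which have to pass through the pivot point `P_i`: those of `A`
belonging to `P_i`, and the `E_j` whose pivot point is `P_i`. -/
def pivotLines {C : Set (Set ι)} (Ψ : Plinth C r) (i : Fin r) : Set (ι ⊕ Fin r) :=
  Sum.inl '' Ψ.pivot i ∪ Sum.inr '' {j | Ψ.pivot j = Ψ.pivot i}

/-- The three lines `S_{i+1}`, `E_i`, `E_{i+1}` which have to be concurrent. -/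
def vertexLines {C : Set (Set ι)} (Ψ : Plinth C r) (i : Fin r) : Set (ι ⊕ Fin r) :=
  {Sum.inl (Ψ.support (i + 1)), Sum.inr i, Sum.inr (i + 1)}

/-- `E` is a splitting polygon on the plinth `Ψ` of `A`: its consecutive edges meet on the
support, its edges pass through the pivot points, and all the other intersections are generic.
The last condition says that the lines of `A ∪ E` are pairwise distinct and that a point on `E_i`
is a double point of `A ∪ E` at most, unless the lines through it are exactly those imposed by the
first two conditions. -/
structure IsSplittingPolygon (A : ι → Line) (Ψ : Plinth (sing A) r) (E : Fin r → Line) :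
    Prop where
  vertex : ∀ i, ∃ x : Point, OnLine x (E i) ∧ OnLine x (E (i + 1)) ∧
    OnLine x (A (Ψ.support (i + 1)))
  pivot : ∀ i, ∃ x : Point, linesThrough A x = Ψ.pivot i ∧ OnLine x (E i)
  distinct : Function.Injective (addLines A E)
  generic : ∀ (x : Point) (i : Fin r), OnLine x (E i) →
    linesThrough (addLines A E) x = pivotLines Ψ i ∨
    (∃ j, linesThrough (addLines A E) x = vertexLines Ψ j) ∨
    (linesThrough (addLines A E) x).encard ≤ 2

end Plinths

/-! ### The polygons `E^λ` and the polynomial `Δ_Ψ` -/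

section Delta

/-- Given coordinates `s_k` of the support lines, `p_k` of the pivot points and `q` of the first
vertex, the coordinates of the successive vertices: the next vertex is the intersection of the
line through the `k`-th vertex and `p_k` with the line `s_{k+1}`. -/
def vertexVec {R : Type*} [CommRing R] (s p : ℕ → Fin 3 → R) (q : Fin 3 → R) : ℕ → Fin 3 → R
  | 0 => q
  | k + 1 => crossProduct (crossProduct (vertexVec s p q k) (p k)) (s (k + 1))

/-- The coordinates of the line through the `k`-th vertex and the `k`-th pivot point. -/
def edgeVec {R : Type*} [CommRing R] (s p : ℕ → Fin 3 → R) (q : Fin 3 → R) (k : ℕ) : Fin 3 → R :=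
  crossProduct (vertexVec s p q k) (p k)

variable {ι : Type*} {r : ℕ} [NeZero r]

/-- Coordinates over the field `K` for the realization in `A` of the plinth `Ψ`, together with a
linear parametrization `λ ↦ u + λ v` over `K` of the first line of the support. -/
structure PlinthCoords (K : Type*) [Field K] [Algebra K ℂ] (A : ι → Line)
    (Ψ : Plinth (sing A) r) where
  /-- coordinates of the support lines -/
  s : Fin r → Fin 3 → K
  /-- coordinates of the pivot points -/
  p : Fin r → Fin 3 → K
  u : Fin 3 → K
  v : Fin 3 → K
  s_spec : ∀ i, IsCoord (s i) (A (Ψ.support i))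
  p_spec : ∀ i, ∃ x : Point, IsCoord (p i) x ∧ linesThrough A x = Ψ.pivot i
  indep : LinearIndependent K ![u, v]
  u_mem : u ⬝ᵥ s 0 = 0
  v_mem : v ⬝ᵥ s 0 = 0

variable {K : Type*} [Field K] [Algebra K ℂ] {A : ι → Line} {Ψ : Plinth (sing A) r}

/-- The polynomial `Δ_Ψ` in `K[λ]`: the determinant of the coefficients of the lines `S_1`,
`E_1^λ` and `E_r^λ`, where `λ` is an indeterminate. -/
def PlinthCoords.delta (c : PlinthCoords K A Ψ) : K[X] :=
  let s : ℕ → Fin 3 → K[X] := fun k j => Polynomial.C (c.s (Fin.ofNat r k) j)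
  let p : ℕ → Fin 3 → K[X] := fun k j => Polynomial.C (c.p (Fin.ofNat r k) j)
  let q : Fin 3 → K[X] := fun j => Polynomial.C (c.u j) + Polynomial.X * Polynomial.C (c.v j)
  Matrix.det (Matrix.of ![s 0, edgeVec s p q 0, edgeVec s p q (r - 1)])

/-- The coordinates of the edges of `E^λ`, for a complex number `λ`. -/
def PlinthCoords.edge (c : PlinthCoords K A Ψ) (lam : ℂ) (i : Fin r) : Fin 3 → ℂ :=
  edgeVec (fun k => toC (c.s (Fin.ofNat r k))) (fun k => toC (c.p (Fin.ofNat r k)))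
    (toC c.u + lam • toC c.v) i

theorem cross_ne_zero_of_dot {q a b : Fin 3 → ℂ} (hq : q ≠ 0) (hqb : q ⬝ᵥ b = 0)
    (hab : a ⬝ᵥ b ≠ 0) : crossProduct q a ≠ 0 := by
  intro h
  have h0 := congrFun h 0
  have h1 := congrFun h 1
  have h2 := congrFun h 2
  simp only [cross_apply, Matrix.cons_val_zero, Matrix.cons_val_one, Matrix.cons_val,
    Pi.zero_apply] at h0 h1 h2
  simp only [dotProduct, Fin.sum_univ_three] at hqb hab
  apply hq
  have key : ∀ i, q i * (a 0 * b 0 + a 1 * b 1 + a 2 * b 2) = 0 := by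
    intro i
    fin_cases i
    · change q 0 * _ = 0
      linear_combination a 0 * hqb + b 1 * h2 - b 2 * h1
    · change q 1 * _ = 0
      linear_combination a 1 * hqb - b 0 * h2 + b 2 * h0
    · change q 2 * _ = 0
      linear_combination a 2 * hqb + b 0 * h1 - b 1 * h0
  funext i
  exact (mul_eq_zero.mp (key i)).resolve_right hab

theorem toC_dot (a b : Fin 3 → K) : toC a ⬝ᵥ toC b = algebraMap K ℂ (a ⬝ᵥ b) := by
  simp [toC, dotProduct]

theorem PlinthCoords.dot_ne_zero (c : PlinthCoords K A Ψ) {i j : Fin r}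
    (h : Ψ.support j ∉ Ψ.pivot i) : toC (c.p i) ⬝ᵥ toC (c.s j) ≠ 0 := by
  intro h0
  obtain ⟨x, ⟨hx, rfl⟩, hP⟩ := c.p_spec i
  obtain ⟨hs, hS⟩ := c.s_spec j
  apply h
  rw [← hP]
  rw [linesThrough, Set.mem_ofPred_eq, hS]
  exact (Projectivization.orthogonal_mk hx hs).mpr h0

theorem PlinthCoords.start_ne_zero (c : PlinthCoords K A Ψ) (lam : ℂ) :
    toC c.u + lam • toC c.v ≠ 0 := by
  intro h
  have hx : crossProduct c.u c.v ≠ 0 := crossProduct_ne_zero_iff_linearIndependent.mpr c.indep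
  have hu : toC c.u = -(lam • toC c.v) := eq_neg_of_add_eq_zero_left h
  have h1 : crossProduct (toC c.u) (toC c.v) = 0 := by
    rw [hu]
    simp
  apply hx
  have h2 : crossProduct (toC c.u) (toC c.v) = toC (crossProduct c.u c.v) := by
    funext i
    fin_cases i <;> simp [cross_apply, toC]
  funext i
  have h3 : algebraMap K ℂ (crossProduct c.u c.v i) = 0 := by
    have := congrFun (h2.symm.trans h1) i
    simpa [toC] using this
  exact (map_eq_zero _).mp h3

theorem PlinthCoords.vertex_aux (c : PlinthCoords K A Ψ) (lam : ℂ) (k : ℕ) :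
    vertexVec (fun k => toC (c.s (Fin.ofNat r k))) (fun k => toC (c.p (Fin.ofNat r k)))
      (toC c.u + lam • toC c.v) k ≠ 0 ∧
    vertexVec (fun k => toC (c.s (Fin.ofNat r k))) (fun k => toC (c.p (Fin.ofNat r k)))
      (toC c.u + lam • toC c.v) k ⬝ᵥ toC (c.s (Fin.ofNat r k)) = 0 := by
  induction k with
  | zero =>
    refine ⟨c.start_ne_zero lam, ?_⟩
    change (toC c.u + lam • toC c.v) ⬝ᵥ toC (c.s 0) = 0
    rw [add_dotProduct, smul_dotProduct, toC_dot, toC_dot, c.u_mem, c.v_mem]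
    simp
  | succ k ih =>
    have hk : Fin.ofNat r (k + 1) = Fin.ofNat r k + 1 := by
      ext
      simp [Fin.val_add]
    have he := cross_ne_zero_of_dot ih.1 ih.2 (c.dot_ne_zero (Ψ.support_notMem (Fin.ofNat r k)))
    constructor
    · refine cross_ne_zero_of_dot (b := toC (c.p (Fin.ofNat r k))) he ?_ ?_
      · rw [dotProduct_comm]
        exact dot_cross_self _ _
      · rw [dotProduct_comm]
        change toC (c.p (Fin.ofNat r k)) ⬝ᵥ toC (c.s (Fin.ofNat r (k + 1))) ≠ 0
        rw [hk]
        exact c.dot_ne_zero (Ψ.support_succ_notMem _)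
    · rw [dotProduct_comm]
      exact dot_cross_self _ _

theorem PlinthCoords.edge_ne_zero (c : PlinthCoords K A Ψ) (lam : ℂ) (i : Fin r) :
    c.edge lam i ≠ 0 := by
  have h := c.vertex_aux lam i
  exact cross_ne_zero_of_dot h.1 h.2 (c.dot_ne_zero (Ψ.support_notMem _))

/-- The tuple of lines `E^λ`: starting with the point `u + λ v` of `S_1`, the `i`-th edge joins the
`i`-th vertex (on `S_i`) to `P_i`, and the next vertex is its intersection with `S_{i+1}`. -/
def PlinthCoords.polygon (c : PlinthCoords K A Ψ) (lam : ℂ) (i : Fin r) : Line :=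
  Projectivization.mk ℂ (c.edge lam i) (c.edge_ne_zero lam i)

/-- A polynomial is reducible: a product of two polynomials of positive degree. -/
def IsReducible (f : K[X]) : Prop :=
  f ≠ 0 ∧ ∃ g h : K[X], 0 < g.natDegree ∧ 0 < h.natDegree ∧ f = g * h

end Delta

end LineArr
end

open LineArr

namespace LineArr

/-! ### Incidence geometry of the projective plane -/

/-! The vertices and edges of the walk along a plinth depend linearly on its starting point, so the
determinant defining `Δ` is a quadratic form on the points of `S_1`, and it vanishes exactly when
the walk closes up (`closing_eq`, `exists_closing_add_smul`). In degree two with distinct roots `μ`,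
`μ'`, the inscribed polygons are therefore `E^μ` and `E^μ'` and no others (`exists_eq_polygon`).

The genericity clause makes the combinatorics of `A ∪ E` depend on the plinth only (`sing_eq`), and
this combinatorics in turn forces a polygon to be inscribed (`isInscribed_of_sing_eq`). Since
restriction to `A` is continuous on moduli and `A` is rigid, each component containing one of the
two completions has at most two points, the classes of `A ∪ E^μ` and `A ∪ E^μ'`. To separate them
without knowing that the quotient is Hausdorff, one uses the closed sets of limits of a class
(`Degenerates`, `isClosed_degenerates`): a nonzero, possibly singular matrix carrying one completion
to the other cannot exist, by `not_degenerates`. Hence both completions are rigid and form a pair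
(`isRigid_and_isPair`).

Arithmetic comes from automorphisms of `ℂ`. If `Δ` is irreducible, some automorphism over `𝔽(A)`
maps one root to the other, hence one polygon to the other: the pair is conjugate, and splitting
passes from one polygon to the other. For triangles the same automorphism yields genericity itself,
because every singular point of `A` is fixed while no edge is (`IsInscribed.isSplittingPolygon`). If
`Δ` is reducible, both roots lie in the base field and the definition field does not grow. A
conjugation between the two completions fixes the base arrangement line by line, so it is the
identity on that field and would identify the two polygons (`eq_of_galoisConjugate`). A
nonarithmetic pair is a completion of the second kind on top of one of the first. -/

theorem onLine_mk {x L : Fin 3 → ℂ} (hx : x ≠ 0) (hL : L ≠ 0) :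
    OnLine (Projectivization.mk ℂ x hx) (Projectivization.mk ℂ L hL) ↔ x ⬝ᵥ L = 0 :=
  Projectivization.orthogonal_mk hx hL

theorem mk_eq_mk_iff_cross {v w : Fin 3 → ℂ} (hv : v ≠ 0) (hw : w ≠ 0) :
    Projectivization.mk ℂ v hv = Projectivization.mk ℂ w hw ↔ crossProduct v w = 0 :=
  Projectivization.mk_eq_mk_iff_crossProduct_eq_zero hv hw

/-- Follows from the expansion `l × (x × y) = (l·y) x - (l·x) y`. It identifies a line with the join
of two of its points. -/
theorem cross_cross_of_dot {R : Type*} [CommRing R] {l x y : Fin 3 → R} (hx : x ⬝ᵥ l = 0)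
    (hy : y ⬝ᵥ l = 0) : crossProduct l (crossProduct x y) = 0 := by
  simp only [dotProduct, Fin.sum_univ_three] at hx hy
  funext i
  fin_cases i
  · simp [cross_apply]
    linear_combination x 0 * hy - y 0 * hx
  · simp [cross_apply]
    linear_combination x 1 * hy - y 1 * hx
  · simp [cross_apply]
    linear_combination x 2 * hy - y 2 * hx

theorem eq_mk_cross {x y : Fin 3 → ℂ} (hx : x ≠ 0) (hy : y ≠ 0) (h : crossProduct x y ≠ 0)
    {L : Line} (h1 : OnLine (Projectivization.mk ℂ x hx) L)
    (h2 : OnLine (Projectivization.mk ℂ y hy) L) :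
    L = Projectivization.mk ℂ (crossProduct x y) h := by
  induction L using Projectivization.ind with | h l hl =>
  rw [onLine_mk] at h1 h2
  rw [mk_eq_mk_iff_cross]
  exact cross_cross_of_dot h1 h2

/-- Two distinct points lie on one line only. -/
theorem line_eq_of_ne {x y : Point} {L M : Line} (hxy : x ≠ y) (h1 : OnLine x L) (h2 : OnLine y L)
    (h3 : OnLine x M) (h4 : OnLine y M) : L = M := by
  induction x using Projectivization.ind with | h v hv =>
  induction y using Projectivization.ind with | h w hw =>
  have h : crossProduct v w ≠ 0 := fun h => hxy ((mk_eq_mk_iff_cross hv hw).2 h)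
  rw [eq_mk_cross hv hw h h1 h2, eq_mk_cross hv hw h h3 h4]

/-- Two distinct lines meet in one point only. -/
theorem point_eq_of_ne {x y : Point} {L M : Line} (hLM : L ≠ M) (h1 : OnLine x L) (h2 : OnLine y L)
    (h3 : OnLine x M) (h4 : OnLine y M) : x = y := by
  by_contra h
  exact hLM (line_eq_of_ne h h1 h2 h3 h4)

theorem exists_onLine_onLine (L M : Line) : ∃ x : Point, OnLine x L ∧ OnLine x M := by
  induction L using Projectivization.ind with | h v hv =>
  induction M using Projectivization.ind with | h w hw =>
  by_cases h : crossProduct v w = 0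
  · obtain ⟨z, hz, hzv⟩ : ∃ z : Fin 3 → ℂ, z ≠ 0 ∧ z ⬝ᵥ v = 0 := by
      by_cases h0 : v 0 = 0
      · exact ⟨![1, 0, 0], fun h => by simpa using congrFun h 0, by simp [dotProduct,
          Fin.sum_univ_three, h0]⟩
      · refine ⟨![- v 1, v 0, 0], fun h => h0 (by simpa using congrFun h 1), ?_⟩
        simp [dotProduct, Fin.sum_univ_three]
        ring
    refine ⟨Projectivization.mk ℂ z hz, (onLine_mk _ _).2 hzv, ?_⟩
    rw [← (mk_eq_mk_iff_cross hv hw).2 h]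
    exact (onLine_mk _ _).2 hzv
  · refine ⟨Projectivization.mk ℂ _ h, (onLine_mk _ _).2 ?_, (onLine_mk _ _).2 ?_⟩
    · rw [dotProduct_comm]; exact dot_self_cross _ _
    · rw [dotProduct_comm]; exact dot_cross_self _ _

section Combinatorics

variable {ι : Type*}

@[simp]
theorem mem_linesThrough {A : ι → Line} {x : Point} {i : ι} :
    i ∈ linesThrough A x ↔ OnLine x (A i) := Iff.rfl

/-- A singular point is determined by two of the lines through it. -/
theorem point_eq_of_nontrivial {A : ι → Line} (hA : Function.Injective A) {P : Set ι}
    (hP : P.Nontrivial) {x y : Point} (hx : P ⊆ linesThrough A x) (hy : P ⊆ linesThrough A y) :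
    x = y := by
  obtain ⟨i, hi, j, hj, hij⟩ := hP
  exact point_eq_of_ne (fun h => hij (hA h)) (hx hi) (hy hi) (hx hj) (hy hj)

theorem linesThrough_mem_sing {A : ι → Line} {x : Point} {i j : ι} (hij : i ≠ j)
    (hi : OnLine x (A i)) (hj : OnLine x (A j)) : linesThrough A x ∈ sing A :=
  ⟨⟨i, hi, j, hj, hij⟩, x, rfl⟩

/-- Elements of `sing` sharing two lines are equal. -/
theorem sing_eq_of_mem {A : ι → Line} (hA : Function.Injective A) {P Q : Set ι} (hP : P ∈ sing A)
    (hQ : Q ∈ sing A) {i j : ι} (hij : i ≠ j) (h1 : i ∈ P) (h2 : j ∈ P) (h3 : i ∈ Q) (h4 : j ∈ Q) :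
    P = Q := by
  obtain ⟨-, x, rfl⟩ := hP
  obtain ⟨-, y, rfl⟩ := hQ
  rw [point_eq_of_ne (fun h => hij (hA h)) h1 h3 h2 h4]

/-- If all the singular points of multiplicity at least three of `A` are in the common family `T`,
then the double points are determined. -/
theorem sing_subset_of_common {A B : ι → Line}
    (hA : Function.Injective A) {T : Set (Set ι)}
    (hTA : T ⊆ sing A) (hTB : T ⊆ sing B) (h2A : ∀ P ∈ sing A, P ∈ T ∨ P.encard ≤ 2)
    (h2B : ∀ P ∈ sing B, P ∈ T ∨ P.encard ≤ 2) : sing A ⊆ sing B := by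
  intro P hP
  rcases h2A P hP with h | h
  · exact hTB h
  obtain ⟨i, hi, j, hj, hij⟩ := hP.1
  have eq_pair : ∀ Q : Set ι, Q.encard ≤ 2 → i ∈ Q → j ∈ Q → Q = {i, j} := by
    intro Q hQ h1 h2
    symm
    apply (Set.toFinite {i, j}).eq_of_subset_of_encard_le
    · rintro _ (rfl | rfl) <;> assumption
    · rwa [Set.encard_pair hij]
  -- The lines `i` and `j` also meet in `B`. That point is either a common one, which must then be
  -- `P`, or a double point, which must be `{i, j}`.
  obtain ⟨x, hx1, hx2⟩ := exists_onLine_onLine (B i) (B j)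
  have hQ := linesThrough_mem_sing hij hx1 hx2
  rcases h2B _ hQ with h' | h'
  · rw [sing_eq_of_mem hA hP (hTA h') hij hi hj hx1 hx2]
    exact hQ
  · rw [eq_pair P h hi hj, ← eq_pair _ h' hx1 hx2]
    exact hQ

theorem injective_of_addLines {r : ℕ} {A : ι → Line} {E : Fin r → Line}
    (h : Function.Injective (addLines A E)) : Function.Injective A :=
  fun i j hij => Sum.inl_injective (h (a₁ := Sum.inl i) (a₂ := Sum.inl j) hij)

/-- The right-hand side involves only `sing B`: the combinatorics of a subfamily is a function of
that of the whole family, so that forgetting lines is well defined on realization spaces. -/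
theorem sing_comp_inl {κ : Type*} (B : ι ⊕ κ → Line) :
    sing (fun i => B (Sum.inl i)) = {P | P.Nontrivial ∧ ∃ X ∈ sing B, P = Sum.inl ⁻¹' X} := by
  ext P
  constructor
  · rintro ⟨hP, x, rfl⟩
    obtain ⟨i, hi, j, hj, hij⟩ := hP
    refine ⟨⟨i, hi, j, hj, hij⟩, linesThrough B x, ?_, rfl⟩
    exact linesThrough_mem_sing (i := Sum.inl i) (j := Sum.inl j) (by simpa using hij) hi hj
  · rintro ⟨hP, X, ⟨-, x, rfl⟩, rfl⟩
    exact ⟨hP, x, rfl⟩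

end Combinatorics
/-! ### The combinatorics of an arrangement completed by a splitting polygon -/

section Inscribed

variable {ι : Type*} {r : ℕ} [NeZero r]

/-- The special intersections of a splitting polygon, without any genericity condition. -/
structure IsInscribed (A : ι → Line) (Ψ : Plinth (sing A) r) (E : Fin r → Line) : Prop where
  vertex : ∀ i, ∃ x : Point, OnLine x (E i) ∧ OnLine x (E (i + 1)) ∧
    OnLine x (A (Ψ.support (i + 1)))
  pivot : ∀ i, ∃ x : Point, linesThrough A x = Ψ.pivot i ∧ OnLine x (E i)

theorem IsSplittingPolygon.isInscribed {A : ι → Line} {Ψ : Plinth (sing A) r} {E : Fin r → Line}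
    (h : IsSplittingPolygon A Ψ E) : IsInscribed A Ψ E := ⟨h.vertex, h.pivot⟩

theorem Plinth.pivot_nontrivial {A : ι → Line} (Ψ : Plinth (sing A) r) (i : Fin r) :
    (Ψ.pivot i).Nontrivial := (Ψ.pivot_mem i).1

theorem Plinth.add_one_ne {C : Set (Set ι)} (Ψ : Plinth C r) (i : Fin r) : i + 1 ≠ i := by
  have h3 := Ψ.three_le
  intro h
  have h1 : (1 : Fin r) = 0 := by simpa using h
  have := congrArg Fin.val h1
  simp [Nat.mod_eq_of_lt (by omega : 1 < r)] at this

theorem Plinth.add_one_add_one_ne {C : Set (Set ι)} (Ψ : Plinth C r) (i : Fin r) :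
    i + 1 + 1 ≠ i := by
  have h3 := Ψ.three_le
  intro h
  have h1 : (1 + 1 : Fin r) = 0 := by simpa [add_assoc] using h
  have := congrArg Fin.val h1
  simp [Fin.val_add, Nat.mod_eq_of_lt (by omega : 1 < r),
    Nat.mod_eq_of_lt (by omega : 2 < r)] at this

variable {A : ι → Line} {Ψ : Plinth (sing A) r} {E E' : Fin r → Line}

theorem three_le_encard {κ : Type*} {X : Set κ} {a b c : κ} (hab : a ≠ b) (hac : a ≠ c)
    (hbc : b ≠ c) (ha : a ∈ X) (hb : b ∈ X) (hc : c ∈ X) : ¬ X.encard ≤ 2 := by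
  intro h
  have h1 : ({a, b, c} : Set κ).encard ≤ X.encard := by
    apply Set.encard_le_encard
    rintro _ (rfl | rfl | rfl) <;> assumption
  rw [Set.encard_insert_of_notMem (by simp [hab, hac]), Set.encard_pair hbc] at h1
  have h2 := h1.trans h
  norm_num at h2

namespace IsSplittingPolygon

/-- The lines through a singular point of `A` lying on an edge are the lines of a pivot. -/
theorem lines_of_mem_sing (h : IsSplittingPolygon A Ψ E) {x : Point} {i : Fin r}
    (hx : OnLine x (E i)) (hS : (linesThrough A x).Nontrivial) :
    linesThrough (addLines A E) x = pivotLines Ψ i := by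
  obtain ⟨a, ha, b, hb, hab⟩ := hS
  rcases h.generic x i hx with h1 | ⟨j, h1⟩ | h1
  · exact h1
  · have ha' : Sum.inl a ∈ linesThrough (addLines A E) x := ha
    have hb' : Sum.inl b ∈ linesThrough (addLines A E) x := hb
    rw [h1] at ha' hb'
    simp [vertexLines] at ha' hb'
    exact absurd (ha'.trans hb'.symm) hab
  · exact absurd h1 (three_le_encard (a := Sum.inl a) (b := Sum.inl b) (c := Sum.inr i)
      (by simpa using hab) (by simp) (by simp) ha hb hx)

theorem pivotLines_mem (h : IsSplittingPolygon A Ψ E) (i : Fin r) :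
    pivotLines Ψ i ∈ sing (addLines A E) := by
  obtain ⟨x, hx, hE⟩ := h.pivot i
  have hn := Ψ.pivot_nontrivial i
  rw [← h.lines_of_mem_sing hE (hx ▸ hn)]
  obtain ⟨a, ha, b, hb, hab⟩ := hn
  rw [← hx] at ha hb
  exact linesThrough_mem_sing (i := Sum.inl a) (j := Sum.inl b) (by simpa using hab) ha hb

theorem vertexLines_mem (h : IsSplittingPolygon A Ψ E) (i : Fin r) :
    vertexLines Ψ i ∈ sing (addLines A E) := by
  obtain ⟨x, h1, h2, h3⟩ := h.vertex i
  have hi := (Ψ.add_one_ne i).symm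
  have key : linesThrough (addLines A E) x = vertexLines Ψ i := by
    rcases h.generic x i h1 with h4 | ⟨j, h4⟩ | h4
    · have h5 : Sum.inl (Ψ.support (i + 1)) ∈ linesThrough (addLines A E) x := h3
      rw [h4] at h5
      simp [pivotLines] at h5
      exact absurd h5 (Ψ.support_succ_notMem i)
    · have h5 : Sum.inr i ∈ linesThrough (addLines A E) x := h1
      have h6 : Sum.inr (i + 1) ∈ linesThrough (addLines A E) x := h2
      rw [h4] at h5 h6
      simp [vertexLines] at h5 h6
      -- Both `i` and `i + 1` lie in `{j, j + 1}`. The alternative to `i = j` would give `i + 2 =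
      -- i`, which `3 ≤ r` excludes.
      have : i = j := by
        rcases h5 with h5 | h5
        · exact h5
        rcases h6 with h6 | h6
        · rw [← h6] at h5
          exact absurd h5.symm (Ψ.add_one_add_one_ne i)
        · exact h6
      rw [h4, this]
    · exact absurd h4 (three_le_encard (a := Sum.inr i) (b := Sum.inr (i + 1))
        (c := Sum.inl (Ψ.support (i + 1))) (by simpa using hi) (by simp) (by simp) h1 h2 h3)
  rw [← key]
  exact linesThrough_mem_sing (i := Sum.inr i) (j := Sum.inr (i + 1)) (by simpa using hi) h1 h2

theorem image_mem (h : IsSplittingPolygon A Ψ E) {P : Set ι} (hP : P ∈ sing A)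
    (hn : ∀ i, Ψ.pivot i ≠ P) : Sum.inl '' P ∈ sing (addLines A E) := by
  obtain ⟨hP, x, rfl⟩ := hP
  have key : linesThrough (addLines A E) x = Sum.inl '' linesThrough A x := by
    ext (a | i)
    · simp [addLines]
    · simp only [Set.mem_image, reduceCtorEq, and_false, exists_false, iff_false]
      intro hi
      have h1 := h.lines_of_mem_sing hi hP
      apply hn i
      ext a
      have h2 := Set.ext_iff.1 h1 (Sum.inl a)
      simpa [pivotLines, addLines] using h2.symm
  rw [← key]
  obtain ⟨a, ha, b, hb, hab⟩ := hP
  exact linesThrough_mem_sing (i := Sum.inl a) (j := Sum.inl b) (by simpa using hab) ha hb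

end IsSplittingPolygon

/-- The singular points of `A ∪ E` which are imposed by the plinth. -/
def imposed (Ψ : Plinth (sing A) r) : Set (Set (ι ⊕ Fin r)) :=
  {X | (∃ P ∈ sing A, (∀ i, Ψ.pivot i ≠ P) ∧ X = Sum.inl '' P) ∨
    (∃ i, X = pivotLines Ψ i) ∨ ∃ i, X = vertexLines Ψ i}

namespace IsSplittingPolygon

theorem imposed_subset (h : IsSplittingPolygon A Ψ E) : imposed Ψ ⊆ sing (addLines A E) := by
  rintro X (⟨P, hP, hn, rfl⟩ | ⟨i, rfl⟩ | ⟨i, rfl⟩)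
  · exact h.image_mem hP hn
  · exact h.pivotLines_mem i
  · exact h.vertexLines_mem i

theorem mem_imposed_or (h : IsSplittingPolygon A Ψ E) {X : Set (ι ⊕ Fin r)}
    (hX : X ∈ sing (addLines A E)) : X ∈ imposed Ψ ∨ X.encard ≤ 2 := by
  obtain ⟨hX, x, rfl⟩ := hX
  by_cases hE : ∃ i, OnLine x (E i)
  · obtain ⟨i, hi⟩ := hE
    rcases h.generic x i hi with h1 | ⟨j, h1⟩ | h1
    · exact Or.inl (Or.inr (Or.inl ⟨i, h1⟩))
    · exact Or.inl (Or.inr (Or.inr ⟨j, h1⟩))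
    · exact Or.inr h1
  · push Not at hE
    have key : linesThrough (addLines A E) x = Sum.inl '' linesThrough A x := by
      ext (a | i)
      · simp [addLines]
      · simpa [addLines] using hE i
    have hP : (linesThrough A x).Nontrivial := by
      rw [key] at hX
      exact Set.nontrivial_of_image _ _ hX
    refine Or.inl (Or.inl ⟨_, ⟨hP, x, rfl⟩, fun i hi => ?_, key⟩)
    obtain ⟨y, hy, hyE⟩ := h.pivot i
    have : x = y := point_eq_of_nontrivial (injective_of_addLines h.distinct) hP subset_rfl
      (by rw [hy, hi])
    exact hE i (this ▸ hyE)

/-- The two arrangements share the imposed points, and every other singular point is double, hence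
determined by what the imposed points leave over. -/
theorem sing_eq (h : IsSplittingPolygon A Ψ E) (h' : IsSplittingPolygon A Ψ E') :
    sing (addLines A E) = sing (addLines A E') :=
  Set.Subset.antisymm
    (sing_subset_of_common h.distinct h.imposed_subset h'.imposed_subset
      (fun _ => h.mem_imposed_or) (fun _ => h'.mem_imposed_or))
    (sing_subset_of_common h'.distinct h'.imposed_subset h.imposed_subset
      (fun _ => h'.mem_imposed_or) (fun _ => h.mem_imposed_or))

/-- The combinatorics remembers the imposed concurrences, so an arrangement in the same moduli space
that extends `A` itself must come from a closed walk. -/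
theorem isInscribed_of_sing_eq (h : IsSplittingPolygon A Ψ E)
    (hs : sing (addLines A E') = sing (addLines A E)) : IsInscribed A Ψ E' where
  vertex i := by
    have h1 := h.vertexLines_mem i
    rw [← hs] at h1
    obtain ⟨-, x, hx⟩ := h1
    have h2 : ∀ k ∈ vertexLines Ψ i, OnLine x (addLines A E' k) := fun k hk => by
      rw [hx] at hk; exact hk
    exact ⟨x, h2 (Sum.inr i) (by simp [vertexLines]), h2 (Sum.inr (i + 1)) (by simp [vertexLines]),
      h2 (Sum.inl _) (by simp [vertexLines])⟩
  pivot i := by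
    have h1 := h.pivotLines_mem i
    rw [← hs] at h1
    obtain ⟨-, x, hx⟩ := h1
    refine ⟨x, ?_, ?_⟩
    · ext a
      have h2 := Set.ext_iff.1 hx (Sum.inl a)
      simpa [pivotLines, addLines] using h2.symm
    · have h2 := Set.ext_iff.1 hx (Sum.inr i)
      simpa [pivotLines, addLines] using h2

/-- The edges of a splitting polygon are not concurrent. -/
theorem not_concurrent (h : IsSplittingPolygon A Ψ E) (x : Point) : ¬ ∀ i, OnLine x (E i) := by
  intro hx
  obtain ⟨y, h1, h2, h3⟩ := h.vertex 0
  have hne : E 0 ≠ E (0 + 1) := fun h0 => Ψ.add_one_ne 0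
    (Sum.inr_injective (h.distinct (a₁ := Sum.inr 0) (a₂ := Sum.inr (0 + 1)) h0)).symm
  -- A common point would be the vertex of `E_0` and `E_1`. It is not a pivot, since a support line
  -- passes through it, and a vertex carries two edges only, whereas there are at least three.
  obtain rfl := point_eq_of_ne hne h1 (hx 0) h2 (hx (0 + 1))
  have hmem := fun i => (show Sum.inr i ∈ linesThrough (addLines A E) y from hx i)
  rcases h.generic y 0 (hx 0) with h4 | ⟨j, h4⟩ | h4
  · have h5 : Sum.inl (Ψ.support (0 + 1)) ∈ linesThrough (addLines A E) y := h3
    rw [h4] at h5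
    simp only [pivotLines, Set.mem_union, Set.mem_image, Sum.inl.injEq, exists_eq_right,
      reduceCtorEq, and_false, exists_false, or_false] at h5
    exact Ψ.support_succ_notMem 0 h5
  · have h5 := hmem (j + 1 + 1)
    rw [h4] at h5
    simp only [vertexLines, Set.mem_insert_iff, reduceCtorEq, Sum.inr.injEq,
      Set.mem_singleton_iff, false_or] at h5
    rcases h5 with h5 | h5
    · exact Ψ.add_one_add_one_ne j h5
    · exact Ψ.add_one_ne (j + 1) h5
  · exact three_le_encard (a := Sum.inr (0 : Fin r)) (b := Sum.inr (0 + 1))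
      (c := Sum.inl (Ψ.support (0 + 1))) (by simpa using (Ψ.add_one_ne 0).symm) (by simp)
      (by simp) (hx 0) (hx _) h3 h4

end IsSplittingPolygon

end Inscribed

theorem sing_comp_inl_of_sing_eq {ι κ : Type*} {A : ι → Line} {E : κ → Line} {B : ι ⊕ κ → Line}
    (hB : sing B = sing (Sum.elim A E)) : sing (fun i => B (Sum.inl i)) = sing A := by
  rw [sing_comp_inl, hB, ← sing_comp_inl]
  rfl

/-! ### Projective transformations -/

section Projective

variable {ι : Type*}

theorem pgl_exists_point (g : PGL(Fin 3, ℂ)) (x : Point) :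
    ∃ y : Point, ∀ L : Line, OnLine y (g • L) ↔ OnLine x L := by
  obtain ⟨g, rfl⟩ := Matrix.ProjGenLinGroup.mk_surjective g
  induction x using Projectivization.ind with | h v hv =>
  -- Points move by the inverse transpose, which preserves the incidence pairing.
  have hmul : ∀ l, (((g⁻¹ : GL (Fin 3) ℂ) : Matrix (Fin 3) (Fin 3) ℂ)ᵀ *ᵥ v) ⬝ᵥ (g • l) =
      v ⬝ᵥ l := by
    intro l
    rw [Matrix.mulVec_transpose, ← Matrix.dotProduct_mulVec]
    congr 1
    change (((g⁻¹ : GL (Fin 3) ℂ) : Matrix (Fin 3) (Fin 3) ℂ)) *ᵥ ((g : Matrix _ _ ℂ) *ᵥ l) = l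
    rw [Matrix.mulVec_mulVec, ← Units.val_mul, inv_mul_cancel]
    simp
  have hw : ((g⁻¹ : GL (Fin 3) ℂ) : Matrix (Fin 3) (Fin 3) ℂ)ᵀ *ᵥ v ≠ 0 := by
    intro h0
    apply hv
    rw [← dotProduct_eq_zero_iff]
    intro l
    rw [← hmul l, h0, zero_dotProduct]
  refine ⟨Projectivization.mk ℂ _ hw, fun L => ?_⟩
  induction L using Projectivization.ind with | h l hl =>
  rw [Projectivization.PGL.mk_smul_mk, onLine_mk, onLine_mk, hmul]

theorem sing_subset_smul (g : PGL(Fin 3, ℂ)) (A : ι → Line) :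
    sing A ⊆ sing (fun i => g • A i) := by
  rintro P ⟨hP, x, rfl⟩
  obtain ⟨y, hy⟩ := pgl_exists_point g x
  exact ⟨hP, y, by ext i; exact (hy _).symm⟩

theorem sing_smul (g : PGL(Fin 3, ℂ)) (A : ι → Line) : sing (fun i => g • A i) = sing A :=
  Set.Subset.antisymm (by simpa using sing_subset_smul g⁻¹ (fun i => g • A i))
    (sing_subset_smul g A)

end Projective
/-! ### Closed walks along a plinth -/

section Walk

/-- Each step of the walk is a cross product with fixed vectors, hence linear. This linearity is
what makes `Δ` quadratic. -/
theorem vertexVec_add_smul {R : Type*} [CommRing R] (s p : ℕ → Fin 3 → R) (a b : R)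
    (q q' : Fin 3 → R) (k : ℕ) : vertexVec s p (a • q + b • q') k =
      a • vertexVec s p q k + b • vertexVec s p q' k := by
  induction k with
  | zero => rfl
  | succ k ih => simp [vertexVec, ih]

theorem edgeVec_add_smul {R : Type*} [CommRing R] (s p : ℕ → Fin 3 → R) (a b : R)
    (q q' : Fin 3 → R) (k : ℕ) : edgeVec s p (a • q + b • q') k =
      a • edgeVec s p q k + b • edgeVec s p q' k := by
  simp [edgeVec, vertexVec_add_smul]

theorem cross_map {R S : Type*} [CommRing R] [CommRing S] (f : R →+* S) (a b : Fin 3 → R) :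
    crossProduct (fun j => f (a j)) (fun j => f (b j)) = fun j => f (crossProduct a b j) := by
  funext j
  fin_cases j <;> simp [cross_apply]

/-- The walk is polynomial in its data. This compatibility serves three times: for evaluating `Δ` at
a number, for base change to `ℂ`, and for the action of field automorphisms. -/
theorem vertexVec_map {R S : Type*} [CommRing R] [CommRing S] (f : R →+* S)
    (s p : ℕ → Fin 3 → R) (q : Fin 3 → R) (k : ℕ) :
    vertexVec (fun k j => f (s k j)) (fun k j => f (p k j)) (fun j => f (q j)) k =
      fun j => f (vertexVec s p q k j) := by
  induction k with
  | zero => rfl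
  | succ k ih => rw [vertexVec, ih, cross_map, cross_map]; rfl

theorem edgeVec_map {R S : Type*} [CommRing R] [CommRing S] (f : R →+* S)
    (s p : ℕ → Fin 3 → R) (q : Fin 3 → R) (k : ℕ) :
    edgeVec (fun k j => f (s k j)) (fun k j => f (p k j)) (fun j => f (q j)) k =
      fun j => f (edgeVec s p q k j) := by
  rw [edgeVec, vertexVec_map, cross_map]; rfl

/-- The determinant of `S_1`, `E_1` and `E_n` for the walk starting at `q`. -/
def closing {R : Type*} [CommRing R] (s p : ℕ → Fin 3 → R) (n : ℕ) (q : Fin 3 → R) : R :=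
  Matrix.det (Matrix.of ![s 0, edgeVec s p q 0, edgeVec s p q n])

theorem closing_map {R S : Type*} [CommRing R] [CommRing S] (f : R →+* S)
    (s p : ℕ → Fin 3 → R) (n : ℕ) (q : Fin 3 → R) :
    closing (fun k j => f (s k j)) (fun k j => f (p k j)) n (fun j => f (q j)) =
      f (closing s p n q) := by
  simp only [closing, edgeVec_map, Matrix.det_fin_three]
  simp

/-- Since `q · s_0 = 0`, the double product `s_0 × (q × p_0)` reduces to `(p_0 · s_0) q`. As the
first pivot is off the first line, the determinant tests whether the last edge passes through the
starting point. -/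
theorem closing_eq {R : Type*} [CommRing R] (s p : ℕ → Fin 3 → R) (n : ℕ) {q : Fin 3 → R}
    (hq : q ⬝ᵥ s 0 = 0) : closing s p n q = (p 0 ⬝ᵥ s 0) * (q ⬝ᵥ edgeVec s p q n) := by
  rw [closing]
  generalize edgeVec s p q n = e
  simp only [edgeVec, vertexVec, Matrix.det_fin_three]
  simp only [dotProduct, Fin.sum_univ_three] at hq ⊢
  simp [cross_apply]
  linear_combination -(p 0 0 * e 0 + p 0 1 * e 1 + p 0 2 * e 2) * hq

/-- Exactly two rows of the determinant are linear in `q`; `b` is the sum of the two mixed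
determinants. -/
theorem exists_closing_add_smul {R : Type*} [CommRing R] (s p : ℕ → Fin 3 → R) (n : ℕ)
    (q q' : Fin 3 → R) : ∃ b : R, ∀ x y : R, closing s p n (x • q + y • q') =
      closing s p n q * x ^ 2 + b * (x * y) + closing s p n q' * y ^ 2 := by
  refine ⟨Matrix.det (Matrix.of ![s 0, edgeVec s p q 0, edgeVec s p q' n]) +
    Matrix.det (Matrix.of ![s 0, edgeVec s p q' 0, edgeVec s p q n]), fun x y => ?_⟩
  simp only [closing, edgeVec_add_smul, Matrix.det_fin_three]
  simp
  ring

end Walk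

/-! ### Inscribed polygons and the roots of `Δ`. -/

section Coords

variable {ι : Type*} {r : ℕ} [NeZero r] {K : Type*} [Field K] [Algebra K ℂ] {A : ι → Line}
  {Ψ : Plinth (sing A) r}

theorem ofNat_succ (k : ℕ) : Fin.ofNat r (k + 1) = Fin.ofNat r k + 1 := by
  ext
  simp [Fin.val_add]

namespace PlinthCoords

variable (c : PlinthCoords K A Ψ)

/-- Complex coordinates of the support lines, indexed periodically. -/
def lineC (k : ℕ) : Fin 3 → ℂ := toC (c.s (Fin.ofNat r k))

/-- Complex coordinates of the pivot points, indexed periodically. -/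
def pivotC (k : ℕ) : Fin 3 → ℂ := toC (c.p (Fin.ofNat r k))

/-- The `k`-th vertex of the walk starting at `q`. -/
abbrev vtx (q : Fin 3 → ℂ) (k : ℕ) : Fin 3 → ℂ := vertexVec c.lineC c.pivotC q k

/-- The `k`-th edge of the walk starting at `q`. -/
abbrev edg (q : Fin 3 → ℂ) (k : ℕ) : Fin 3 → ℂ := edgeVec c.lineC c.pivotC q k

theorem pivotC_dot (k : ℕ) : c.pivotC k ⬝ᵥ c.lineC k ≠ 0 :=
  c.dot_ne_zero (Ψ.support_notMem _)

theorem pivotC_dot_succ (k : ℕ) : c.pivotC k ⬝ᵥ c.lineC (k + 1) ≠ 0 := by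
  rw [lineC, ofNat_succ]
  exact c.dot_ne_zero (Ψ.support_succ_notMem _)

theorem pivotC_ne_zero (k : ℕ) : c.pivotC k ≠ 0 := fun h => c.pivotC_dot k (by simp [h])

theorem lineC_ne_zero (k : ℕ) : c.lineC k ≠ 0 := fun h => c.pivotC_dot k (by simp [h])

/-- The walk never breaks down: a pivot off `S_k` has a genuine join with the vertex on `S_k`, and a
pivot off `S_{k+1}` makes this join meet `S_{k+1}` in a single point. -/
theorem vtx_spec {q : Fin 3 → ℂ} (hq : q ≠ 0) (hs : q ⬝ᵥ c.lineC 0 = 0) (k : ℕ) :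
    c.vtx q k ≠ 0 ∧ c.vtx q k ⬝ᵥ c.lineC k = 0 := by
  induction k with
  | zero => exact ⟨hq, hs⟩
  | succ k ih =>
    have he := cross_ne_zero_of_dot ih.1 ih.2 (c.pivotC_dot k)
    constructor
    · refine cross_ne_zero_of_dot (b := c.pivotC k) he ?_ ?_
      · rw [dotProduct_comm]
        exact dot_cross_self _ _
      · rw [dotProduct_comm]
        exact c.pivotC_dot_succ k
    · rw [dotProduct_comm]
      exact dot_cross_self _ _

theorem edg_ne_zero {q : Fin 3 → ℂ} (hq : q ≠ 0) (hs : q ⬝ᵥ c.lineC 0 = 0) (k : ℕ) :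
    c.edg q k ≠ 0 :=
  cross_ne_zero_of_dot (c.vtx_spec hq hs k).1 (c.vtx_spec hq hs k).2 (c.pivotC_dot k)

theorem line_eq (k : ℕ) :
    A (Ψ.support (Fin.ofNat r k)) = Projectivization.mk ℂ (c.lineC k) (c.lineC_ne_zero k) := by
  obtain ⟨_, h⟩ := c.s_spec (Fin.ofNat r k)
  exact h

theorem linesThrough_pivotC (k : ℕ) :
    linesThrough A (Projectivization.mk ℂ (c.pivotC k) (c.pivotC_ne_zero k)) =
      Ψ.pivot (Fin.ofNat r k) := by
  obtain ⟨x, ⟨_, rfl⟩, hx⟩ := c.p_spec (Fin.ofNat r k)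
  exact hx

variable {q : Fin 3 → ℂ} (hq : q ≠ 0) (hs : q ⬝ᵥ c.lineC 0 = 0)

/-- The `k`-th vertex of the walk, as a point. -/
noncomputable def vertexPt (k : ℕ) : Point := Projectivization.mk ℂ (c.vtx q k) (c.vtx_spec hq hs k).1

/-- The `k`-th edge of the walk, as a line. -/
noncomputable def edgeLn (k : ℕ) : Line := Projectivization.mk ℂ (c.edg q k) (c.edg_ne_zero hq hs k)

/-- The `k`-th pivot point. -/
noncomputable def pivotPt (k : ℕ) : Point := Projectivization.mk ℂ (c.pivotC k) (c.pivotC_ne_zero k)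

theorem vertexPt_support (k : ℕ) : OnLine (c.vertexPt hq hs k) (A (Ψ.support (Fin.ofNat r k))) := by
  rw [c.line_eq]
  exact (onLine_mk _ _).2 (c.vtx_spec hq hs k).2

theorem vertexPt_edgeLn (k : ℕ) : OnLine (c.vertexPt hq hs k) (c.edgeLn hq hs k) :=
  (onLine_mk _ _).2 (dot_self_cross _ _)

theorem vertexPt_succ_edgeLn (k : ℕ) : OnLine (c.vertexPt hq hs (k + 1)) (c.edgeLn hq hs k) :=
  (onLine_mk _ _).2 (by rw [dotProduct_comm]; exact dot_self_cross _ _)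

theorem pivotPt_edgeLn (k : ℕ) : OnLine (c.pivotPt k) (c.edgeLn hq hs k) :=
  (onLine_mk _ _).2 (dot_cross_self _ _)

theorem pivotPt_support (k : ℕ) : ¬ OnLine (c.pivotPt k) (A (Ψ.support (Fin.ofNat r k))) := by
  rw [c.line_eq]
  exact fun h => c.pivotC_dot k ((onLine_mk _ _).1 h)

theorem pivotPt_support_succ (k : ℕ) :
    ¬ OnLine (c.pivotPt k) (A (Ψ.support (Fin.ofNat r (k + 1)))) := by
  rw [c.line_eq]
  exact fun h => c.pivotC_dot_succ k ((onLine_mk _ _).1 h)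

theorem edgeLn_ne_support (k : ℕ) : c.edgeLn hq hs k ≠ A (Ψ.support (Fin.ofNat r k)) :=
  fun h => c.pivotPt_support k (h ▸ c.pivotPt_edgeLn hq hs k)

theorem edgeLn_ne_support_succ (k : ℕ) :
    c.edgeLn hq hs k ≠ A (Ψ.support (Fin.ofNat r (k + 1))) :=
  fun h => c.pivotPt_support_succ k (h ▸ c.pivotPt_edgeLn hq hs k)

theorem vertexPt_ne_pivotPt (k : ℕ) : c.vertexPt hq hs k ≠ c.pivotPt k :=
  fun h => c.pivotPt_support k (h ▸ c.vertexPt_support hq hs k)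

theorem vertexPt_succ_ne_pivotPt (k : ℕ) : c.vertexPt hq hs (k + 1) ≠ c.pivotPt k :=
  fun h => c.pivotPt_support_succ k (h ▸ c.vertexPt_support hq hs (k + 1))

theorem linesThrough_pivotPt (k : ℕ) : linesThrough A (c.pivotPt k) = Ψ.pivot (Fin.ofNat r k) :=
  c.linesThrough_pivotC k

theorem eq_pivotPt (hA : Function.Injective A) (k : ℕ) {x : Point}
    (hx : linesThrough A x = Ψ.pivot (Fin.ofNat r k)) : x = c.pivotPt k :=
  point_eq_of_nontrivial hA (Ψ.pivot_nontrivial _) hx.ge (c.linesThrough_pivotPt k).ge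

/-- A point of the first line of the support. -/
theorem start_dot (lam : ℂ) : (toC c.u + lam • toC c.v) ⬝ᵥ c.lineC 0 = 0 :=
  (c.vertex_aux lam 0).2

theorem polygon_eq (lam : ℂ) (k : ℕ) (hk : k < r) :
    c.polygon lam (Fin.ofNat r k) = c.edgeLn (c.start_ne_zero lam) (c.start_dot lam) k := by
  have : ((Fin.ofNat r k : Fin r) : ℕ) = k := Nat.mod_eq_of_lt hk
  simp only [polygon, edgeLn, edge, this]
  rfl

theorem ofNat_val (i : Fin r) : Fin.ofNat r (i : ℕ) = i := by
  ext
  simp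

theorem toC_linearIndependent : crossProduct (toC c.u) (toC c.v) ≠ 0 := by
  have h2 : crossProduct (toC c.u) (toC c.v) = toC (crossProduct c.u c.v) :=
    cross_map (algebraMap K ℂ) c.u c.v
  intro h
  apply crossProduct_ne_zero_iff_linearIndependent.mpr c.indep
  funext i
  have h3 := congrFun (h2.symm.trans h) i
  exact (map_eq_zero (algebraMap K ℂ)).mp h3

/-- The walks starting at distinct points never share an edge. -/
theorem polygon_injective (i : Fin r) : Function.Injective fun lam => c.polygon lam i := by
  have key : ∀ (lam lam' : ℂ) (k : ℕ),
      c.edgeLn (c.start_ne_zero lam) (c.start_dot lam) k =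
        c.edgeLn (c.start_ne_zero lam') (c.start_dot lam') k →
      c.vertexPt (c.start_ne_zero lam) (c.start_dot lam) 0 =
        c.vertexPt (c.start_ne_zero lam') (c.start_dot lam') 0 := by
    intro lam lam' k hk
    -- The walk is run backwards: an edge determines its vertex on the support line, and this vertex
    -- together with the preceding pivot determines the preceding edge.
    have hv := point_eq_of_ne (c.edgeLn_ne_support (c.start_ne_zero lam) (c.start_dot lam) k)
      (c.vertexPt_edgeLn _ _ k) (hk ▸ c.vertexPt_edgeLn _ (c.start_dot lam') k)
      (c.vertexPt_support _ _ k) (c.vertexPt_support _ (c.start_dot lam') k)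
    induction k with
    | zero => exact hv
    | succ k ih =>
      have h1 : c.edgeLn (c.start_ne_zero lam) (c.start_dot lam) k =
          c.edgeLn (c.start_ne_zero lam') (c.start_dot lam') k :=
        line_eq_of_ne (c.vertexPt_succ_ne_pivotPt (c.start_ne_zero lam) (c.start_dot lam) k)
          (c.vertexPt_succ_edgeLn _ _ k) (c.pivotPt_edgeLn _ _ k)
          (hv ▸ c.vertexPt_succ_edgeLn _ _ k) (c.pivotPt_edgeLn _ _ k)
      refine ih h1 (point_eq_of_ne (c.edgeLn_ne_support (c.start_ne_zero lam) (c.start_dot lam) k)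
        (c.vertexPt_edgeLn _ _ k) (h1 ▸ c.vertexPt_edgeLn _ (c.start_dot lam') k)
        (c.vertexPt_support _ _ k) (c.vertexPt_support _ (c.start_dot lam') k))
  intro lam lam' h
  have h1 := (mk_eq_mk_iff_cross _ _).1 (key lam lam' i h)
  -- The cross product of `u + λv` and `u + λ'v` is `(λ' - λ) u × v`.
  have h2 : (lam' - lam) • crossProduct (toC c.u) (toC c.v) = 0 := by
    rw [← h1]
    simp only [vertexVec, map_add, LinearMap.add_apply, map_smul, LinearMap.smul_apply, cross_self,
      ← cross_anticomm (toC c.u) (toC c.v)]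
    module
  rcases smul_eq_zero.1 h2 with h3 | h3
  · exact (sub_eq_zero.1 h3).symm
  · exact absurd h3 c.toC_linearIndependent

/-! #### The polynomial `Δ` -/

/-- The value of `Δ` at a point of the first line of the support. -/
def closingC (q : Fin 3 → ℂ) : ℂ := closing c.lineC c.pivotC (r - 1) q

theorem aeval_delta (lam : ℂ) :
    Polynomial.aeval lam c.delta = c.closingC (toC c.u + lam • toC c.v) := by
  have h := closing_map (Polynomial.aeval lam : K[X] →ₐ[K] ℂ).toRingHom
    (fun k j => Polynomial.C (c.s (Fin.ofNat r k) j))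
    (fun k j => Polynomial.C (c.p (Fin.ofNat r k) j)) (r - 1)
    (fun j => Polynomial.C (c.u j) + Polynomial.X * Polynomial.C (c.v j))
  refine Eq.trans h.symm ?_
  simp only [AlgHom.toRingHom_eq_coe, RingHom.coe_coe, Polynomial.aeval_C, map_add, map_mul,
    Polynomial.aeval_X]
  rfl

/-- The leading coefficient is the value of the form at `v`, the point `λ = ∞` of `S_1`. Degree two
thus means that the walk starting at `v` does not close. -/
theorem map_delta : ∃ b : ℂ, c.delta.map (algebraMap K ℂ) =
    Polynomial.C (c.closingC (toC c.v)) * Polynomial.X ^ 2 + Polynomial.C b * Polynomial.X +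
      Polynomial.C (c.closingC (toC c.u)) := by
  obtain ⟨b, hb⟩ := exists_closing_add_smul c.lineC c.pivotC (r - 1) (toC c.u) (toC c.v)
  refine ⟨b, Polynomial.funext fun lam => ?_⟩
  have h := hb 1 lam
  rw [one_smul] at h
  rw [Polynomial.eval_map_algebraMap, aeval_delta, closingC, h]
  simp only [closingC, Polynomial.eval_add, Polynomial.eval_mul, Polynomial.eval_C,
    Polynomial.eval_pow, Polynomial.eval_X]
  ring

theorem natDegree_delta_le : c.delta.natDegree ≤ 2 := by
  obtain ⟨b, hb⟩ := c.map_delta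
  rw [← Polynomial.natDegree_map (algebraMap K ℂ), hb]
  exact Polynomial.natDegree_quadratic_le

theorem closingC_v_ne_zero (h : c.delta.natDegree = 2) : c.closingC (toC c.v) ≠ 0 := by
  intro h0
  obtain ⟨b, hb⟩ := c.map_delta
  rw [← Polynomial.natDegree_map (algebraMap K ℂ), hb, h0, map_zero, zero_mul, zero_add] at h
  have := Polynomial.natDegree_linear_le (a := b) (b := c.closingC (toC c.u))
  omega

theorem closingC_smul (a : ℂ) (q : Fin 3 → ℂ) : c.closingC (a • q) = a ^ 2 * c.closingC q := by
  obtain ⟨b, hb⟩ := exists_closing_add_smul c.lineC c.pivotC (r - 1) q 0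
  have h := hb a 0
  simp only [smul_zero, add_zero, mul_zero, ne_eq, OfNat.ofNat_ne_zero, not_false_eq_true,
    zero_pow] at h
  rw [closingC, h, closingC, mul_comm]

theorem u_dot : toC c.u ⬝ᵥ c.lineC 0 = 0 :=
  (toC_dot _ _).trans (by rw [show Fin.ofNat r 0 = 0 from rfl, c.u_mem, map_zero])

theorem v_dot : toC c.v ⬝ᵥ c.lineC 0 = 0 :=
  (toC_dot _ _).trans (by rw [show Fin.ofNat r 0 = 0 from rfl, c.v_mem, map_zero])

theorem v_ne_zero : toC c.v ≠ 0 := fun h => c.toC_linearIndependent (by rw [h, map_zero])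

/-- The form `Δ` vanishes exactly when the walk closes up. -/
theorem closingC_eq_zero_iff : c.closingC q = 0 ↔
    OnLine (c.vertexPt hq hs 0) (c.edgeLn hq hs (r - 1)) := by
  rw [closingC, closing_eq _ _ _ hs, mul_eq_zero, or_iff_right (c.pivotC_dot 0)]
  exact (onLine_mk _ _).symm

theorem ofNat_sub_one_add_one : Fin.ofNat r (r - 1) + 1 = 0 := by
  rw [← ofNat_succ, Nat.sub_add_cancel (Nat.one_le_iff_ne_zero.2 (NeZero.ne r))]
  ext
  simp

/-- A root of `Δ` gives an inscribed polygon. -/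
theorem isInscribed {lam : ℂ} (h : Polynomial.aeval lam c.delta = 0) :
    IsInscribed A Ψ (c.polygon lam) where
  vertex i := by
    by_cases hi : (i : ℕ) + 1 < r
    · refine ⟨c.vertexPt (c.start_ne_zero lam) (c.start_dot lam) (i + 1), ?_, ?_, ?_⟩
      · exact c.vertexPt_succ_edgeLn _ _ i
      · have h1 := c.polygon_eq lam _ hi
        rw [ofNat_succ, ofNat_val] at h1
        rw [h1]
        exact c.vertexPt_edgeLn _ _ _
      · have h1 := c.vertexPt_support (c.start_ne_zero lam) (c.start_dot lam) (i + 1)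
        rwa [ofNat_succ, ofNat_val] at h1
    -- Only the last vertex, where the index wraps around, uses the vanishing of `Δ`.
    · have hi' : (i : ℕ) = r - 1 := by have := i.2; omega
      have h0 : i + 1 = 0 := by
        rw [← ofNat_val i, hi', ofNat_sub_one_add_one]
      rw [c.aeval_delta, c.closingC_eq_zero_iff (c.start_ne_zero lam) (c.start_dot lam),
        ← hi'] at h
      refine ⟨_, h, ?_, ?_⟩
      · rw [h0]
        exact c.vertexPt_edgeLn _ _ 0
      · rw [h0]
        exact c.vertexPt_support _ _ 0
  pivot i := by
    refine ⟨c.pivotPt i, ?_, c.pivotPt_edgeLn (c.start_ne_zero lam) (c.start_dot lam) i⟩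
    rw [linesThrough_pivotPt, ofNat_val]

theorem exists_eq_smul_add_smul (hs : q ⬝ᵥ c.lineC 0 = 0) :
    ∃ a b : ℂ, q = a • toC c.u + b • toC c.v := by
  have hw := c.toC_linearIndependent
  have h2 : crossProduct (c.lineC 0) (crossProduct (toC c.u) (toC c.v)) = 0 :=
    cross_cross_of_dot c.u_dot c.v_dot
  have h3 := (mk_eq_mk_iff_cross (c.lineC_ne_zero 0) hw).2 h2
  rw [Projectivization.mk_eq_mk_iff'] at h3
  obtain ⟨t, ht⟩ := h3
  rw [← ht, dotProduct_smul, smul_eq_mul, mul_eq_zero] at hs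
  have hqw : q ⬝ᵥ crossProduct (toC c.u) (toC c.v) = 0 := hs.resolve_left fun h0 =>
    c.lineC_ne_zero 0 (by rw [← ht, h0, zero_smul])
  obtain ⟨z, hz⟩ : ∃ z, crossProduct (toC c.u) (toC c.v) ⬝ᵥ z ≠ 0 := by
    by_contra! h
    exact hw ((dotProduct_eq_zero_iff).1 h)
  -- Cramer's rule in the plane spanned by `u` and `v`, with areas measured by pairing with `z`.
  refine ⟨(crossProduct q (toC c.v) ⬝ᵥ z) / (crossProduct (toC c.u) (toC c.v) ⬝ᵥ z),
    (crossProduct (toC c.u) q ⬝ᵥ z) / (crossProduct (toC c.u) (toC c.v) ⬝ᵥ z), ?_⟩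
  funext j
  simp only [Pi.add_apply, Pi.smul_apply, smul_eq_mul]
  rw [div_mul_eq_mul_div, div_mul_eq_mul_div, ← add_div, eq_div_iff hz]
  simp only [dotProduct, Fin.sum_univ_three, cross_apply, Matrix.cons_val_zero,
    Matrix.cons_val_one, Matrix.cons_val] at hqw ⊢
  fin_cases j
  · simp only [Fin.zero_eta]
    linear_combination z 0 * hqw
  · simp only [Fin.mk_one]
    linear_combination z 1 * hqw
  · simp only [Fin.reduceFinMk]
    linear_combination z 2 * hqw

/-- When `Δ` has degree two, the inscribed polygons are the `E^μ` for `μ` a root of `Δ`. -/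
theorem exists_eq_polygon (hA : Function.Injective A) (hd : c.delta.natDegree = 2)
    {E : Fin r → Line} (hE : IsInscribed A Ψ E) :
    ∃ lam : ℂ, Polynomial.aeval lam c.delta = 0 ∧ E = c.polygon lam := by
  have hpiv : ∀ k, OnLine (c.pivotPt k) (E (Fin.ofNat r k)) := by
    intro k
    obtain ⟨x, hx, hxE⟩ := hE.pivot (Fin.ofNat r k)
    rwa [← c.eq_pivotPt hA k hx]
  obtain ⟨x, hx1, hx2, hx3⟩ := hE.vertex (Fin.ofNat r (r - 1))
  rw [ofNat_sub_one_add_one] at hx2 hx3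
  induction x using Projectivization.ind with | h q hq =>
  have hs : q ⬝ᵥ c.lineC 0 = 0 := by
    have h1 := c.line_eq 0
    rw [show Fin.ofNat r 0 = 0 from rfl] at h1
    rw [h1] at hx3
    exact (onLine_mk _ _).1 hx3
  -- An inscribed polygon coincides with the walk from its vertex on `S_1`. This is stated for every
  -- representative `q`, as it is applied again after rescaling to `u + λv`.
  have key : ∀ (q : Fin 3 → ℂ) (hq : q ≠ 0) (hs : q ⬝ᵥ c.lineC 0 = 0),
      OnLine (Projectivization.mk ℂ q hq) (E 0) → ∀ k,
      OnLine (c.vertexPt hq hs k) (E (Fin.ofNat r k)) ∧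
        E (Fin.ofNat r k) = c.edgeLn hq hs k := by
    intro q hq hs h0 k
    have step : ∀ k, OnLine (c.vertexPt hq hs k) (E (Fin.ofNat r k)) →
        E (Fin.ofNat r k) = c.edgeLn hq hs k := fun k hk =>
      line_eq_of_ne (c.vertexPt_ne_pivotPt hq hs k) hk (hpiv k) (c.vertexPt_edgeLn hq hs k)
        (c.pivotPt_edgeLn hq hs k)
    induction k with
    | zero => exact ⟨h0, step 0 h0⟩
    | succ k ih =>
      suffices h : OnLine (c.vertexPt hq hs (k + 1)) (E (Fin.ofNat r (k + 1))) from ⟨h, step _ h⟩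
      obtain ⟨y, hy1, hy2, hy3⟩ := hE.vertex (Fin.ofNat r k)
      rw [← ofNat_succ] at hy2 hy3
      rw [ih.2] at hy1
      rwa [point_eq_of_ne (c.edgeLn_ne_support_succ hq hs k) (c.vertexPt_succ_edgeLn hq hs k) hy1
        (c.vertexPt_support hq hs (k + 1)) hy3]
  obtain ⟨a, b, hab⟩ := c.exists_eq_smul_add_smul hs
  have hclose : c.closingC q = 0 := by
    rw [c.closingC_eq_zero_iff hq hs, ← (key q hq hs hx2 (r - 1)).2]
    exact hx1
  -- If `a = 0` the polygon starts at the point `v`, where the form does not vanish in degree two.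
  have ha : a ≠ 0 := by
    rintro rfl
    rw [zero_smul, zero_add] at hab
    rw [hab, closingC_smul, mul_eq_zero, or_iff_left (c.closingC_v_ne_zero hd)] at hclose
    apply hq
    rw [hab, pow_eq_zero_iff two_ne_zero |>.1 hclose, zero_smul]
  have hq' : q = a • (toC c.u + (b / a) • toC c.v) := by
    rw [hab, smul_add, smul_smul, mul_div_cancel₀ _ ha]
  have hpt : Projectivization.mk ℂ q hq =
      Projectivization.mk ℂ (toC c.u + (b / a) • toC c.v) (c.start_ne_zero _) :=
    (Projectivization.mk_eq_mk_iff' _ _ _ _ _).2 ⟨a, hq'.symm⟩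
  refine ⟨b / a, ?_, ?_⟩
  · rw [hq', closingC_smul, mul_eq_zero, or_iff_right (pow_ne_zero 2 ha)] at hclose
    rw [aeval_delta, hclose]
  · funext i
    have h1 := (key _ (c.start_ne_zero (b / a)) (c.start_dot _) (hpt ▸ hx2) i).2
    rw [ofNat_val] at h1
    exact h1

end PlinthCoords
end Coords
/-! ### Limits of projectively equivalent arrangements -/

section Topology

theorem cross_eq_zero_iff_exists {v w : Fin 3 → ℂ} (hw : w ≠ 0) :
    crossProduct v w = 0 ↔ ∃ a : ℂ, v = a • w := by
  constructor
  · intro h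
    by_cases hv : v = 0
    · exact ⟨0, by simp [hv]⟩
    · have h1 := (mk_eq_mk_iff_cross hv hw).2 h
      rw [Projectivization.mk_eq_mk_iff'] at h1
      obtain ⟨a, ha⟩ := h1
      exact ⟨a, ha.symm⟩
  · rintro ⟨a, rfl⟩
    simp

/-- The saturation of an open set is the union of its rescalings. Openness ensures that the product
with an identity map is still a quotient map, so that closedness can be tested on vectors. -/
theorem isOpenQuotientMap_mk' :
    IsOpenQuotientMap (Projectivization.mk' ℂ : {v : Fin 3 → ℂ // v ≠ 0} → ℙ ℂ (Fin 3 → ℂ)) where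
  surjective := fun L => ⟨⟨L.rep, L.rep_nonzero⟩, L.mk_rep⟩
  continuous := continuous_coinduced_rng
  isOpenMap := by
    intro U hU
    rw [isOpen_coinduced]
    have key : Projectivization.mk' ℂ ⁻¹' (Projectivization.mk' ℂ '' U) =
        ⋃ a : ℂˣ, (fun v : {v : Fin 3 → ℂ // v ≠ 0} =>
          (⟨a • v.1, (smul_ne_zero_iff_ne a).2 v.2⟩ : {v : Fin 3 → ℂ // v ≠ 0})) ⁻¹' U := by
      ext v
      simp only [Set.mem_preimage, Set.mem_image, Set.mem_iUnion]
      constructor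
      · rintro ⟨w, hw, hwv⟩
        obtain ⟨a, ha⟩ := (Projectivization.mk_eq_mk_iff ℂ w.1 v.1 w.2 v.2).1 hwv
        refine ⟨a, ?_⟩
        convert hw
      · rintro ⟨a, ha⟩
        exact ⟨_, ha, (Projectivization.mk_eq_mk_iff ℂ _ _ _ _).2 ⟨a, rfl⟩⟩
    rw [key]
    refine isOpen_iUnion fun a => hU.preimage ?_
    exact Continuous.subtype_mk (continuous_subtype_val.const_smul a) _

variable {ι : Type*}

/-- `B` is a limit of arrangements which are projectively equivalent to `A`: some nonzero, possibly
singular, linear map sends the lines of `A` to those of `B`. -/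
def Degenerates (A B : ι → Line) : Prop :=
  ∃ g : Matrix (Fin 3) (Fin 3) ℂ, g ≠ 0 ∧
    ∀ i, crossProduct (g *ᵥ (A i).rep) (B i).rep = 0

theorem degenerates_refl (A : ι → Line) : Degenerates A A :=
  ⟨1, one_ne_zero, fun i => by simp⟩

theorem exists_smul_rep (g : PGL(Fin 3, ℂ)) : ∃ h : GL (Fin 3) ℂ, ∀ L : Line, ∃ a : ℂ,
    (h : Matrix (Fin 3) (Fin 3) ℂ) *ᵥ L.rep = a • (g • L).rep := by
  obtain ⟨h, rfl⟩ := Matrix.ProjGenLinGroup.mk_surjective g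
  refine ⟨h, fun L => ?_⟩
  have h1 : Matrix.ProjGenLinGroup.mk h • L = Projectivization.mk ℂ (h • L.rep)
      ((smul_ne_zero_iff_ne h).2 L.rep_nonzero) := by
    conv_lhs => rw [← L.mk_rep]
    exact Projectivization.PGL.mk_smul_mk h L.rep_nonzero
  have h2 : Projectivization.mk ℂ (h • L.rep) ((smul_ne_zero_iff_ne h).2 L.rep_nonzero) =
      Projectivization.mk ℂ (Matrix.ProjGenLinGroup.mk h • L).rep
        (Projectivization.rep_nonzero _) := by
    rw [Projectivization.mk_rep, h1]
  obtain ⟨a, ha⟩ := (Projectivization.mk_eq_mk_iff' _ _ _ _ _).1 h2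
  exact ⟨a, ha.symm⟩

theorem Degenerates.smul {A B : ι → Line} (hAB : Degenerates A B) (h : PGL(Fin 3, ℂ)) :
    Degenerates A (fun i => h • B i) := by
  obtain ⟨g, hg, hgi⟩ := hAB
  obtain ⟨h', hh'⟩ := exists_smul_rep h
  refine ⟨(h' : Matrix _ _ ℂ) * g, fun h0 => hg ?_, fun i => ?_⟩
  · have : ((h'⁻¹ : GL (Fin 3) ℂ) : Matrix _ _ ℂ) * ((h' : Matrix _ _ ℂ) * g) = 0 := by
      rw [h0, mul_zero]
    rwa [← mul_assoc, ← Units.val_mul, inv_mul_cancel, Units.val_one, one_mul] at this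
  · obtain ⟨a, ha⟩ := (cross_eq_zero_iff_exists (B i).rep_nonzero).1 (hgi i)
    obtain ⟨b, hb⟩ := hh' (B i)
    rw [cross_eq_zero_iff_exists (Projectivization.rep_nonzero _), ← Matrix.mulVec_mulVec, ha,
      Matrix.mulVec_smul, hb]
    exact ⟨a * b, by rw [smul_smul]⟩

/-- The relation is closed in the pair of matrix and arrangement, and invariant under rescaling the
matrix. Matrices can thus be normalized to the unit sphere, and projection along a compact factor is
closed. Singular matrices have to be allowed, since invertible ones of norm one are not compact. -/
theorem isClosed_degenerates (A : ι → Line) : IsClosed {B | Degenerates A B} := by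
  let M : Type := Fin 3 → Fin 3 → ℂ
  have h1 : ∀ i, IsClosed {p : M × Line |
      crossProduct (Matrix.of p.1 *ᵥ (A i).rep) p.2.rep = 0} := by
    intro i
    have hq : IsOpenQuotientMap (Prod.map id (Projectivization.mk' ℂ) :
        M × {v : Fin 3 → ℂ // v ≠ 0} → M × Line) :=
      IsOpenQuotientMap.id.prodMap isOpenQuotientMap_mk'
    rw [← hq.isQuotientMap.isClosed_preimage]
    have h2 : (Prod.map id (Projectivization.mk' ℂ)) ⁻¹' {p : M × Line |
        crossProduct (Matrix.of p.1 *ᵥ (A i).rep) p.2.rep = 0} =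
        {p : M × {v : Fin 3 → ℂ // v ≠ 0} |
          crossProduct (Matrix.of p.1 *ᵥ (A i).rep) p.2.1 = 0} := by
      ext ⟨g, v, hv⟩
      simp only [Set.mem_preimage, Prod.map_apply, id_eq, Set.mem_ofPred_eq]
      have h3 : Projectivization.mk ℂ (Projectivization.mk ℂ v hv).rep
        (Projectivization.rep_nonzero _) = Projectivization.mk ℂ v hv := Projectivization.mk_rep _
      obtain ⟨a, ha⟩ := (Projectivization.mk_eq_mk_iff _ _ _ _ _).1 h3
      change crossProduct _ (Projectivization.mk ℂ v hv).rep = 0 ↔ _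
      rw [← ha, Units.smul_def, map_smul, smul_eq_zero_iff_right a.ne_zero]
    rw [h2]
    refine isClosed_eq ?_ continuous_const
    refine continuous_pi fun j => ?_
    have hc : ∀ k, Continuous fun p : M × {v : Fin 3 → ℂ // v ≠ 0} => p.2.1 k := fun k =>
      (continuous_apply k).comp (continuous_subtype_val.comp continuous_snd)
    have hg : ∀ k l, Continuous fun p : M × {v : Fin 3 → ℂ // v ≠ 0} => p.1 k l := fun k l =>
      (continuous_apply l).comp ((continuous_apply k).comp continuous_fst)
    have hm : ∀ k, Continuous fun p : M × {v : Fin 3 → ℂ // v ≠ 0} =>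
        (Matrix.of p.1 *ᵥ (A i).rep) k := fun k => by
      simp only [Matrix.mulVec, dotProduct, Matrix.of_apply]
      exact continuous_finsetSum _ fun l _ => (hg k l).mul continuous_const
    fin_cases j <;> simp only [cross_apply] <;>
      exact ((hm _).mul (hc _)).sub ((hm _).mul (hc _))
  let S := Metric.sphere (0 : M) 1
  have : CompactSpace S := isCompact_iff_compactSpace.1 (isCompact_sphere _ _)
  have h2 : IsClosed {p : S × (ι → Line) |
      ∀ i, crossProduct (Matrix.of p.1.1 *ᵥ (A i).rep) (p.2 i).rep = 0} := by
    rw [Set.ofPred_forall]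
    refine isClosed_iInter fun i => ?_
    exact (h1 i).preimage (f := fun p : S × (ι → Line) => ((p.1.1, p.2 i) : M × Line))
      ((continuous_subtype_val.comp continuous_fst).prodMk
        ((continuous_apply i).comp continuous_snd))
  convert isClosedMap_snd_of_compactSpace _ h2 using 1
  ext B
  simp only [Set.mem_ofPred_eq, Set.mem_image, Prod.exists, exists_eq_right]
  constructor
  · rintro ⟨g, hg, hgi⟩
    let G : M := fun i j => g i j
    have hG : G ≠ 0 := hg
    refine ⟨⟨((‖G‖⁻¹ : ℝ) : ℂ) • G, ?_⟩, fun i => ?_⟩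
    · rw [mem_sphere_zero_iff_norm, norm_smul, Complex.norm_real, norm_inv, norm_norm,
        inv_mul_cancel₀ (norm_ne_zero_iff.2 hG)]
    · change crossProduct ((((‖G‖⁻¹ : ℝ) : ℂ) • g) *ᵥ (A i).rep) (B i).rep = 0
      rw [Matrix.smul_mulVec, map_smul, LinearMap.smul_apply, hgi i, smul_zero]
  · rintro ⟨⟨g, hg⟩, hgi⟩
    refine ⟨Matrix.of g, fun h0 => ?_, hgi⟩
    have : g = 0 := h0
    rw [this] at hg
    simp [S] at hg

end Topology

/-! ### Closed sets in moduli spaces, and restriction to a subarrangement. -/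

section Moduli

variable {ι : Type*}

theorem Realization.cls_eq_iff {C : Set (Set ι)} {a b : Realization C} :
    a.cls = b.cls ↔ ∃ g : PGL(Fin 3, ℂ), ∀ i, g • a.1 i = b.1 i := Quotient.eq

/-- The closed set of the limits of a given class. -/
theorem isClosed_moduli_degenerates (C : Set (Set ι)) (A : ι → Line) :
    IsClosed {x : Moduli C | ∃ b : Realization C, b.cls = x ∧ Degenerates A b.1} := by
  have hq : Topology.IsQuotientMap (Realization.cls : Realization C → Moduli C) :=
    isQuotientMap_quot_mk
  rw [← hq.isClosed_preimage]
  have h : (Realization.cls : Realization C → Moduli C) ⁻¹'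
      {x | ∃ b : Realization C, b.cls = x ∧ Degenerates A b.1} =
      {b : Realization C | Degenerates A b.1} := by
    refine Set.ext fun b => ⟨?_, fun h => ⟨b, rfl, h⟩⟩
    rintro ⟨b', hb', h⟩
    obtain ⟨g, hg⟩ := Realization.cls_eq_iff.1 hb'
    have := h.smul g
    simp only [hg] at this
    exact this
  rw [h]
  exact (isClosed_degenerates A).preimage continuous_subtype_val

theorem isRigid_of_realization {C : Set (Set ι)} (a : Realization C)
    (h : connectedComponent a.cls = {a.cls}) : IsRigid a.1 := by
  obtain ⟨A, hA, rfl⟩ := a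
  exact ⟨⟨A, hA, rfl⟩, rfl, h⟩

theorem IsRigid.injective {A : ι → Line} (h : IsRigid A) : Function.Injective A := by
  obtain ⟨a, ha, -⟩ := h
  exact ha ▸ a.2.1

theorem IsRigid.component {A : ι → Line} (h : IsRigid A) (a : Realization (sing A))
    (ha : a.1 = A) : connectedComponent a.cls = {a.cls} := by
  obtain ⟨b, hb, h⟩ := h
  have : a = b := Subtype.ext (ha.trans hb.symm)
  rwa [this]

/-- Restriction of an arrangement to a subfamily. -/
def Realization.restrict {κ : Type*} {C : Set (Set (ι ⊕ κ))} {D : Set (Set ι)}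
    (h : ∀ B : ι ⊕ κ → Line, sing B = C → sing (fun i => B (Sum.inl i)) = D)
    (b : Realization C) : Realization D :=
  ⟨fun i => b.1 (Sum.inl i), b.2.1.comp Sum.inl_injective, h _ b.2.2⟩

theorem continuous_restrict {κ : Type*} {C : Set (Set (ι ⊕ κ))} {D : Set (Set ι)}
    (h : ∀ B : ι ⊕ κ → Line, sing B = C → sing (fun i => B (Sum.inl i)) = D) :
    Continuous (Realization.restrict h) := by
  have h1 : Continuous fun (b : Realization C) (i : ι) => b.1 (Sum.inl i) :=
    continuous_pi fun i => (continuous_apply (Sum.inl i)).comp continuous_subtype_val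
  exact h1.subtype_mk _

/-- If the restriction of an arrangement is rigid, then the arrangements in its component restrict
to the same class. -/
theorem restrict_cls_eq {κ : Type*} {C : Set (Set (ι ⊕ κ))} {D : Set (Set ι)}
    (h : ∀ B : ι ⊕ κ → Line, sing B = C → sing (fun i => B (Sum.inl i)) = D)
    {a b : Realization C} (ha : connectedComponent (a.restrict h).cls = {(a.restrict h).cls})
    (hb : b.cls ∈ connectedComponent a.cls) : (b.restrict h).cls = (a.restrict h).cls := by
  let ρ : Moduli C → Moduli D := Quotient.map (Realization.restrict h)
    fun _ _ ⟨g, hg⟩ => ⟨g, fun i => hg (Sum.inl i)⟩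
  have hρ : Continuous ρ := (continuous_restrict h).quotient_map' _
  have h1 := hρ.image_connectedComponent_subset a.cls ⟨_, hb, rfl⟩
  change (b.restrict h).cls ∈ connectedComponent (a.restrict h).cls at h1
  rwa [ha] at h1

end Moduli

/-! ### Rigidity of the completed arrangements -/

section Rigidity

variable {ι : Type*} {r : ℕ} [NeZero r] {K : Type*} [Field K] [Algebra K ℂ] {A : ι → Line}
  {Ψ : Plinth (sing A) r}

/-- It suffices that `t` avoid `0` and the finitely many eigenvalues of `-g`. This replaces a
singular degeneration by an invertible matrix with the same eigenvectors. -/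
theorem exists_det_smul_one_add_ne_zero (g : Matrix (Fin 3) (Fin 3) ℂ) :
    ∃ t : ℂ, t ≠ 0 ∧ (t • (1 : Matrix (Fin 3) (Fin 3) ℂ) + g).det ≠ 0 := by
  have hne : (Matrix.charpoly (-g)) * Polynomial.X ≠ 0 :=
    mul_ne_zero (Matrix.charpoly_monic _).ne_zero Polynomial.X_ne_zero
  obtain ⟨t, ht⟩ : ∃ t : ℂ, ((Matrix.charpoly (-g)) * Polynomial.X).eval t ≠ 0 := by
    by_contra! h
    exact hne (Polynomial.funext (by simpa using h))
  rw [Polynomial.eval_mul, Polynomial.eval_X, Matrix.eval_charpoly] at ht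
  refine ⟨t, right_ne_zero_of_mul ht, ?_⟩
  convert left_ne_zero_of_mul ht using 2
  rw [sub_neg_eq_add, Matrix.scalar_apply, Matrix.smul_one_eq_diagonal]

/-- Completing by the polygons of two distinct roots of `Δ` yields classes none of which is a
limit of the other. -/
theorem PlinthCoords.not_degenerates (c : PlinthCoords K A Ψ) (hd : c.delta.natDegree = 2)
    {μ μ' : ℂ} (hne : μ ≠ μ')
    (hroots : ∀ lam : ℂ, Polynomial.aeval lam c.delta = 0 → lam = μ ∨ lam = μ')
    (hsplit : IsSplittingPolygon A Ψ (c.polygon μ)) :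
    ¬ Degenerates (addLines A (c.polygon μ)) (addLines A (c.polygon μ')) := by
  rintro ⟨g, hg, hgi⟩
  obtain ⟨t, ht, hdet⟩ := exists_det_smul_one_add_ne_zero g
  let G : GL (Fin 3) ℂ := Matrix.GeneralLinearGroup.mkOfDetNeZero _ hdet
  have hG : ∀ v : Fin 3 → ℂ, G • v = t • v + g *ᵥ v := fun v => by
    change (t • (1 : Matrix (Fin 3) (Fin 3) ℂ) + g) *ᵥ v = _
    rw [Matrix.add_mulVec, Matrix.smul_mulVec, Matrix.one_mulVec]
  have hGL : ∀ L : Line, Matrix.ProjGenLinGroup.mk G • L = Projectivization.mk ℂ (G • L.rep)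
      ((smul_ne_zero_iff_ne G).2 L.rep_nonzero) := fun L => by
    conv_lhs => rw [← L.mk_rep]
    exact Projectivization.PGL.mk_smul_mk G L.rep_nonzero
  -- Each line of `A` is an eigenvector of `g`, hence of `t + g`. The invertible `G` therefore fixes
  -- `A` and maps `E^μ` to some inscribed polygon `E^λ`.
  have hGA : ∀ i, Matrix.ProjGenLinGroup.mk G • A i = A i := by
    intro i
    obtain ⟨a, ha⟩ := (cross_eq_zero_iff_exists (A i).rep_nonzero).1 (hgi (Sum.inl i))
    have ha' : g *ᵥ (A i).rep = a • (A i).rep := ha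
    rw [hGL]
    conv_rhs => rw [← (A i).mk_rep]
    exact (Projectivization.mk_eq_mk_iff' _ _ _ _ _).2
      ⟨t + a, by rw [hG, ha', add_smul]⟩
  have hsing := sing_smul (Matrix.ProjGenLinGroup.mk G) (addLines A (c.polygon μ))
  have heq : (fun i => Matrix.ProjGenLinGroup.mk G • addLines A (c.polygon μ) i) =
      addLines A (fun j => Matrix.ProjGenLinGroup.mk G • c.polygon μ j) := by
    funext i
    rcases i with i | j
    · exact hGA i
    · rfl
  rw [heq] at hsing
  obtain ⟨lam, hlam, hE⟩ := c.exists_eq_polygon (injective_of_addLines hsplit.distinct) hd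
    (hsplit.isInscribed_of_sing_eq hsing)
  have hedge : ∀ j, ∃ a b : ℂ, g *ᵥ (c.polygon μ j).rep = a • (c.polygon μ' j).rep ∧
      t • (c.polygon μ j).rep + a • (c.polygon μ' j).rep = b • (c.polygon lam j).rep := by
    intro j
    obtain ⟨a, ha⟩ := (cross_eq_zero_iff_exists (c.polygon μ' j).rep_nonzero).1 (hgi (Sum.inr j))
    have ha' : g *ᵥ (c.polygon μ j).rep = a • (c.polygon μ' j).rep := ha
    have h1 := congrFun hE j
    rw [hGL] at h1
    conv_rhs at h1 => rw [← (c.polygon lam j).mk_rep]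
    obtain ⟨b, hb⟩ := (Projectivization.mk_eq_mk_iff' _ _ _ _ _).1 h1
    exact ⟨a, b, ha', by rw [hb, hG, ha']⟩
  have hind : ∀ j, ∀ a : ℂ, a • (c.polygon μ' j).rep ≠ (c.polygon μ j).rep := by
    intro j a ha
    apply hne
    apply c.polygon_injective j
    change c.polygon μ j = c.polygon μ' j
    rw [← (c.polygon μ j).mk_rep, ← (c.polygon μ' j).mk_rep]
    exact (Projectivization.mk_eq_mk_iff' _ _ _ _ _).2 ⟨a, ha⟩
  -- If `λ = μ`, independence of the edges of `E^μ` and `E^μ'` forces `a = 0`, so `g` kills every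
  -- edge of `E^μ`. A nonzero row of `g` is then a point common to all the edges, which is
  -- impossible.
  rcases hroots lam hlam with rfl | rfl
  · have hker : ∀ j, g *ᵥ (c.polygon lam j).rep = 0 := by
      intro j
      obtain ⟨a, b, h1, h2⟩ := hedge j
      by_cases ha : a = 0
      · rw [h1, ha, zero_smul]
      exfalso
      have h3 : a • (c.polygon μ' j).rep = (b - t) • (c.polygon lam j).rep := by
        rw [sub_smul, ← h2]
        module
      by_cases hb : b - t = 0
      · rw [hb, zero_smul, smul_eq_zero] at h3
        exact h3.elim ha (Projectivization.rep_nonzero _)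
      · apply hind j ((b - t)⁻¹ * a)
        rw [mul_smul, h3, smul_smul, inv_mul_cancel₀ hb, one_smul]
    obtain ⟨k, hk⟩ : ∃ k, g k ≠ 0 := by
      by_contra! h
      exact hg (by ext i j; rw [h i]; rfl)
    refine hsplit.not_concurrent (Projectivization.mk ℂ (g k) hk) fun j => ?_
    rw [← (c.polygon lam j).mk_rep, onLine_mk]
    exact congrFun (hker j) k
  -- If `λ = μ'`, then `t` times the first edge of `E^μ` is a multiple of that of `E^μ'`, although
  -- `t ≠ 0`.
  · obtain ⟨a, b, h1, h2⟩ := hedge 0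
    apply hind 0 (t⁻¹ * (b - a))
    rw [mul_smul, sub_smul, ← h2, add_sub_cancel_right, smul_smul, inv_mul_cancel₀ ht, one_smul]

/-- The two completions of a rigid arrangement by the polygons of the two roots of `Δ` are isolated
and distinct points of their moduli space. -/
theorem PlinthCoords.component_eq (c : PlinthCoords K A Ψ) (hA : IsRigid A)
    (hd : c.delta.natDegree = 2) {μ μ' : ℂ} (hne : μ ≠ μ')
    (hroots : ∀ lam : ℂ, Polynomial.aeval lam c.delta = 0 → lam = μ ∨ lam = μ')
    (hsplit : IsSplittingPolygon A Ψ (c.polygon μ))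
    (hsplit' : IsSplittingPolygon A Ψ (c.polygon μ'))
    {C : Set (Set (ι ⊕ Fin r))} (hC : C = sing (addLines A (c.polygon μ)))
    (a a' : Realization C) (ha : a.1 = addLines A (c.polygon μ)) (ha' : a'.1 = addLines A (c.polygon μ')) :
    connectedComponent a.cls = {a.cls} ∧ connectedComponent a'.cls = {a'.cls} ∧
      a.cls ≠ a'.cls := by
  have hres : ∀ B : ι ⊕ Fin r → Line, sing B = C → sing (fun i => B (Sum.inl i)) = sing A :=
    fun B hB => sing_comp_inl_of_sing_eq (hB.trans hC)
  have hclosed := fun x : ℂ => isClosed_moduli_degenerates C (addLines A (c.polygon x))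
  set Z := fun x : ℂ => {y : Moduli C | ∃ b : Realization C, b.cls = y ∧
    Degenerates (addLines A (c.polygon x)) b.1} with hZ
  have hn : ∀ x : Realization C, ∀ B, Degenerates B x.1 ↔
      x.cls ∈ {y : Moduli C | ∃ b : Realization C, b.cls = y ∧ Degenerates B b.1} := by
    intro x B
    refine ⟨fun h => ⟨x, rfl, h⟩, ?_⟩
    rintro ⟨b, hb, h⟩
    obtain ⟨g, hg⟩ := Realization.cls_eq_iff.1 hb
    have := h.smul g
    simp only [hg] at this
    exact this
  have haZ : a.cls ∈ Z μ := (hn a _).1 (by rw [ha]; exact degenerates_refl _)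
  have haZ' : a'.cls ∈ Z μ' := (hn a' _).1 (by rw [ha']; exact degenerates_refl _)
  have hnot : a'.cls ∉ Z μ := fun h => c.not_degenerates hd hne hroots hsplit
    (by rw [← ha']; exact (hn a' _).2 h)
  have hnot' : a.cls ∉ Z μ' := fun h => c.not_degenerates hd hne.symm
    (fun lam hl => (hroots lam hl).symm) hsplit' (by rw [← ha]; exact (hn a _).2 h)
  -- By rigidity of `A`, a class in the component restricts to the class of `A`. Moved by a
  -- projectivity it becomes `A` completed by an inscribed polygon, which leaves two possibilities.
  have hfib : ∀ x : Realization C, x.1 ∘ Sum.inl = A → ∀ y ∈ connectedComponent x.cls,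
      y = a.cls ∨ y = a'.cls := by
    intro x hx y hy
    obtain ⟨b, rfl⟩ : ∃ b : Realization C, b.cls = y := Quotient.exists_rep y
    have h1 := restrict_cls_eq hres (hA.component (x.restrict hres) hx) hy
    obtain ⟨g, hg⟩ := Realization.cls_eq_iff.1 h1
    have hb : (fun i => g • b.1 i) = addLines A (fun j => g • b.1 (Sum.inr j)) := by
      funext i
      rcases i with i | j
      · exact (hg i).trans (congrFun hx i)
      · rfl
    have hs := (sing_smul g b.1).trans (b.2.2.trans hC)
    rw [hb] at hs
    obtain ⟨lam, hlam, hE⟩ := c.exists_eq_polygon hA.injective hd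
      (hsplit.isInscribed_of_sing_eq hs)
    rw [hE] at hb
    rcases hroots lam hlam with rfl | rfl
    · exact Or.inl (Realization.cls_eq_iff.2 ⟨g, fun i => by rw [ha]; exact congrFun hb i⟩)
    · exact Or.inr (Realization.cls_eq_iff.2 ⟨g, fun i => by rw [ha']; exact congrFun hb i⟩)
  -- The component is covered by two closed sets, each containing just one of the two classes;
  -- connectedness excludes that it contains both.
  have hsep : ∀ x : Realization C, x.1 ∘ Sum.inl = A →
      ¬ (a.cls ∈ connectedComponent x.cls ∧ a'.cls ∈ connectedComponent x.cls) := by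
    rintro x hx ⟨h1, h2⟩
    have hpre := isPreconnected_closed_iff.1
      (isPreconnected_connectedComponent (x := x.cls)) (Z μ) (Z μ') (hclosed μ) (hclosed μ')
      (fun y hy => by
        rcases hfib x hx y hy with rfl | rfl
        · exact Or.inl haZ
        · exact Or.inr haZ') ⟨_, h1, haZ⟩ ⟨_, h2, haZ'⟩
    obtain ⟨y, hy, hy1, hy2⟩ := hpre
    rcases hfib x hx y hy with rfl | rfl
    · exact hnot' hy2
    · exact hnot hy1
  have hax : a.1 ∘ Sum.inl = A := by rw [ha]; rfl
  have hax' : a'.1 ∘ Sum.inl = A := by rw [ha']; rfl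
  refine ⟨?_, ?_, fun h => hnot (h ▸ haZ)⟩
  · refine Set.Subset.antisymm (fun y hy => ?_) (by simpa using mem_connectedComponent)
    rcases hfib a hax y hy with h | rfl
    · exact h
    · exact absurd ⟨mem_connectedComponent, hy⟩ (hsep a hax)
  · refine Set.Subset.antisymm (fun y hy => ?_) (by simpa using mem_connectedComponent)
    rcases hfib a' hax' y hy with rfl | h
    · exact absurd ⟨hy, mem_connectedComponent⟩ (hsep a' hax')
    · exact h

theorem PlinthCoords.isRigid_and_isPair (c : PlinthCoords K A Ψ) (hA : IsRigid A)
    (hd : c.delta.natDegree = 2) {μ μ' : ℂ} (hne : μ ≠ μ')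
    (hroots : ∀ lam : ℂ, Polynomial.aeval lam c.delta = 0 → lam = μ ∨ lam = μ')
    (hsplit : IsSplittingPolygon A Ψ (c.polygon μ))
    (hsplit' : IsSplittingPolygon A Ψ (c.polygon μ')) :
    IsRigid (addLines A (c.polygon μ)) ∧ IsRigid (addLines A (c.polygon μ')) ∧
      IsPair (addLines A (c.polygon μ)) (addLines A (c.polygon μ')) := by
  let a : Realization (sing (addLines A (c.polygon μ))) := ⟨_, hsplit.distinct, rfl⟩
  let a' : Realization (sing (addLines A (c.polygon μ))) :=
    ⟨_, hsplit'.distinct, hsplit'.sing_eq hsplit⟩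
  obtain ⟨h1, h2, h3⟩ := c.component_eq hA hd hne hroots hsplit hsplit' rfl a a' rfl rfl
  refine ⟨isRigid_of_realization a h1, isRigid_of_realization a' h2, _, a, a', rfl, rfl, ?_⟩
  rw [h1, h2]
  exact fun h => h3 (Set.singleton_injective h)

end Rigidity
/-! ### Field automorphisms -/

section Automorphisms

/-- An automorphism of a field extends to any algebraically closed extension. -/
theorem exists_ringEquiv_extending {L Ω : Type*} [Field L] [Field Ω] [Algebra L Ω] [IsAlgClosed Ω]
    (σ : L ≃+* L) : ∃ τ : Ω ≃+* Ω, ∀ x, τ (algebraMap L Ω x) = algebraMap L Ω (σ x) := by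
  obtain ⟨s, hs⟩ := exists_isTranscendenceBasis L Ω
  let v : s → Ω := Subtype.val
  let R := Algebra.adjoin L (Set.range v)
  have hcl : IsAlgClosure R Ω := IsAlgClosed.isAlgClosure_of_transcendence_basis v hs
  -- `R` is a polynomial ring over `L` on a transcendence basis. `σ` acts on coefficients, and the
  -- result extends to `Ω`, an algebraic closure of `R`.
  let e : R ≃+* R := hs.1.aevalEquiv.symm.toRingEquiv.trans
    ((MvPolynomial.mapEquiv s σ).trans hs.1.aevalEquiv.toRingEquiv)
  refine ⟨IsAlgClosure.equivOfEquiv Ω Ω e, fun x => ?_⟩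
  have h1 : algebraMap L Ω x = algebraMap R Ω (algebraMap L R x) := rfl
  have h2 : algebraMap L Ω (σ x) = algebraMap R Ω (algebraMap L R (σ x)) := rfl
  rw [h1, h2, IsAlgClosure.equivOfEquiv_algebraMap]
  congr 1
  simp only [e, RingEquiv.trans_apply, AlgEquiv.coe_ringEquiv,
    AlgEquiv.commutes]
  rw [MvPolynomial.algebraMap_eq, MvPolynomial.mapEquiv_apply, MvPolynomial.map_C,
    ← MvPolynomial.algebraMap_eq]
  exact hs.1.aevalEquiv.commutes (σ x)

/-- The roots are conjugate in the algebraic closure of `K` inside `Ω`, and that automorphism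
extends across a transcendence basis. -/
theorem exists_algEquiv_of_irreducible {K Ω : Type*} [Field K] [Field Ω] [Algebra K Ω]
    [IsAlgClosed Ω] {f : K[X]} (hf : Irreducible f) {x y : Ω} (hx : Polynomial.aeval x f = 0)
    (hy : Polynomial.aeval y f = 0) : ∃ τ : Ω ≃ₐ[K] Ω, τ x = y := by
  let L := algebraicClosure K Ω
  have hxa : IsAlgebraic K x := ⟨f, hf.ne_zero, hx⟩
  have hya : IsAlgebraic K y := ⟨f, hf.ne_zero, hy⟩
  let x' : L := ⟨x, mem_algebraicClosure_iff.2 hxa⟩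
  let y' : L := ⟨y, mem_algebraicClosure_iff.2 hya⟩
  have hcl : IsAlgClosure K L := inferInstance
  have hn : Normal K L := IsAlgClosure.normal K L
  have hx' : IsAlgebraic K x' := hcl.isAlgebraic.isAlgebraic x'
  have hmin : Polynomial.aeval y (minpoly K x) = 0 := by
    rw [minpoly.eq_of_irreducible hf hx |>.symm]
    simp [hy]
  have hmin' : Polynomial.aeval y' (minpoly K x') = 0 := by
    apply (algebraMap L Ω).injective
    rw [map_zero, ← Polynomial.aeval_algebraMap_apply, ← minpoly.algebraMap_eq
      (algebraMap L Ω).injective]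
    exact hmin
  obtain ⟨σ, hσ⟩ := minpoly.exists_algEquiv_of_root' hx' hmin'
  obtain ⟨τ, hτ⟩ := exists_ringEquiv_extending (Ω := Ω) σ.toRingEquiv
  refine ⟨AlgEquiv.ofRingEquiv (f := τ) fun a => ?_, ?_⟩
  · have h1 := hτ (algebraMap K L a)
    rw [AlgEquiv.coe_ringEquiv, AlgEquiv.commutes] at h1
    exact h1
  · have h1 := hτ x'
    rw [AlgEquiv.coe_ringEquiv, hσ] at h1
    exact h1

theorem conj_ne_zero (τ : ℂ ≃+* ℂ) {v : Fin 3 → ℂ} (hv : v ≠ 0) : (fun j => τ (v j)) ≠ 0 := by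
  intro h
  apply hv
  funext j
  have := congrFun h j
  simpa using this

/-- The action of an automorphism of `ℂ` on the projective plane. -/
noncomputable def conj (τ : ℂ ≃+* ℂ) (L : ℙ ℂ (Fin 3 → ℂ)) : ℙ ℂ (Fin 3 → ℂ) :=
  Projectivization.mk ℂ (fun j => τ (L.rep j)) (conj_ne_zero τ L.rep_nonzero)

theorem conj_mk (τ : ℂ ≃+* ℂ) {v : Fin 3 → ℂ} (hv : v ≠ 0) :
    conj τ (Projectivization.mk ℂ v hv) =
      Projectivization.mk ℂ (fun j => τ (v j)) (conj_ne_zero τ hv) := by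
  have h : Projectivization.mk ℂ (Projectivization.mk ℂ v hv).rep
    (Projectivization.rep_nonzero _) = Projectivization.mk ℂ v hv := Projectivization.mk_rep _
  obtain ⟨a, ha⟩ := (Projectivization.mk_eq_mk_iff' _ _ _ _ _).1 h
  refine (Projectivization.mk_eq_mk_iff' _ _ _ _ _).2 ⟨τ a, ?_⟩
  funext j
  rw [Pi.smul_apply, smul_eq_mul, ← map_mul, ← ha]
  rfl

theorem onLine_conj (τ : ℂ ≃+* ℂ) {x : Point} {L : Line} :
    OnLine (conj τ x) (conj τ L) ↔ OnLine x L := by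
  induction x using Projectivization.ind with | h v hv =>
  induction L using Projectivization.ind with | h l hl =>
  rw [conj_mk, conj_mk, onLine_mk, onLine_mk]
  have : (fun j => τ (v j)) ⬝ᵥ (fun j => τ (l j)) = τ (v ⬝ᵥ l) := by
    simp [dotProduct]
  rw [this, map_eq_zero_iff τ τ.injective]

theorem conj_symm (τ : ℂ ≃+* ℂ) (x : ℙ ℂ (Fin 3 → ℂ)) : conj τ (conj τ.symm x) = x := by
  induction x using Projectivization.ind with | h v hv =>
  rw [conj_mk, conj_mk]
  simp

theorem conj_injective (τ : ℂ ≃+* ℂ) : Function.Injective (conj τ) :=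
  Function.LeftInverse.injective (g := conj τ.symm) fun x => conj_symm τ.symm x

variable {ι : Type*} {r : ℕ} [NeZero r] {A : ι → Line} {Ψ : Plinth (sing A) r} {E : Fin r → Line}

/-- All the conditions are incidences, and these are preserved by field automorphisms. -/
theorem IsSplittingPolygon.conj (h : IsSplittingPolygon A Ψ E) {τ : ℂ ≃+* ℂ}
    (hA : ∀ i, conj τ (A i) = A i) : IsSplittingPolygon A Ψ (fun i => conj τ (E i)) := by
  have hadd : ∀ i, addLines A (fun i => LineArr.conj τ (E i)) i =
      LineArr.conj τ (addLines A E i) := by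
    rintro (i | i)
    · exact (hA i).symm
    · rfl
  have hlines : ∀ x, linesThrough A (LineArr.conj τ x) = linesThrough A x := fun x => by
    ext i
    rw [mem_linesThrough, mem_linesThrough]
    conv_lhs => rw [← hA i]
    exact onLine_conj τ
  refine ⟨fun i => ?_, fun i => ?_, fun i j hij => ?_, fun x i hx => ?_⟩
  · obtain ⟨x, h1, h2, h3⟩ := h.vertex i
    refine ⟨LineArr.conj τ x, (onLine_conj τ).2 h1, (onLine_conj τ).2 h2, ?_⟩
    rw [← hA]
    exact (onLine_conj τ).2 h3
  · obtain ⟨x, h1, h2⟩ := h.pivot i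
    exact ⟨LineArr.conj τ x, (hlines x).trans h1, (onLine_conj τ).2 h2⟩
  · rw [hadd, hadd] at hij
    exact h.distinct (conj_injective τ hij)
  · obtain ⟨y, rfl⟩ : ∃ y, LineArr.conj τ y = x := ⟨_, conj_symm τ x⟩
    have h1 : linesThrough (addLines A fun i => LineArr.conj τ (E i)) (LineArr.conj τ y) =
        linesThrough (addLines A E) y := by
      ext i
      rw [mem_linesThrough, mem_linesThrough, hadd, onLine_conj]
    rw [h1]
    exact h.generic y i ((onLine_conj τ).1 hx)

theorem conj_mk_algebraMap {K : Type*} [Field K] [Algebra K ℂ] (τ : ℂ ≃ₐ[K] ℂ)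
    {a : Fin 3 → K} (ha : toC a ≠ 0) :
    conj τ.toRingEquiv (Projectivization.mk ℂ (toC a) ha) = Projectivization.mk ℂ (toC a) ha := by
  rw [conj_mk]
  congr 1
  funext j
  exact τ.commutes (a j)

/-- The coordinates of the plinth lie in `K`, so only the parameter `λ` moves. -/
theorem PlinthCoords.conj_polygon {K : Type*} [Field K] [Algebra K ℂ] (c : PlinthCoords K A Ψ)
    (τ : ℂ ≃ₐ[K] ℂ) (lam : ℂ) (i : Fin r) :
    conj τ.toRingEquiv (c.polygon lam i) = c.polygon (τ lam) i := by
  rw [PlinthCoords.polygon, conj_mk, PlinthCoords.polygon]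
  congr 1
  have h := edgeVec_map (τ : ℂ →+* ℂ) (fun k => toC (c.s (Fin.ofNat r k)))
    (fun k => toC (c.p (Fin.ofNat r k))) (toC c.u + lam • toC c.v) i
  refine Eq.trans h.symm ?_
  rw [PlinthCoords.edge]
  congr 1
  · funext k j; exact τ.commutes _
  · funext k j; exact τ.commutes _
  · funext j
    simp [toC]

/-- A line over the definition field has coordinates in it. -/
theorem exists_isCoord_defField (A : ι → Line) (i : ι) (F : IntermediateField ℚ ℂ)
    (hF : defField A ≤ F) : ∃ a : Fin 3 → F, IsCoord a (A i) := by
  obtain ⟨j, hj⟩ : ∃ j, (A i).rep j ≠ 0 := by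
    by_contra! h
    exact (A i).rep_nonzero (funext h)
  have hcoord : IsCoord (A i).rep (A i) := ⟨(A i).rep_nonzero, (A i).mk_rep.symm⟩
  refine ⟨fun k => ⟨(A i).rep k / (A i).rep j, hF (IntermediateField.subset_adjoin _ _
    ⟨i, _, j, k, hcoord, hj, rfl⟩)⟩, ?_⟩
  have h : toC (fun k => (⟨(A i).rep k / (A i).rep j, hF (IntermediateField.subset_adjoin _ _
    ⟨i, _, j, k, hcoord, hj, rfl⟩)⟩ : F)) = ((A i).rep j)⁻¹ • (A i).rep := by
    funext k
    simp [toC, div_eq_inv_mul]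
  have h0 : ((A i).rep j)⁻¹ • (A i).rep ≠ 0 := smul_ne_zero (inv_ne_zero hj) (A i).rep_nonzero
  refine ⟨h ▸ h0, ?_⟩
  conv_lhs => rw [← (A i).mk_rep]
  exact (Projectivization.mk_eq_mk_iff' _ _ _ _ _).2 ⟨(A i).rep j, by
    rw [h, smul_smul, mul_inv_cancel₀ hj, one_smul]⟩

theorem defField_le {A : ι → Line} {F : IntermediateField ℚ ℂ}
    (h : ∀ i, ∃ a : Fin 3 → F, IsCoord a (A i)) : defField A ≤ F := by
  rw [defField, IntermediateField.adjoin_le_iff]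
  rintro z ⟨i, a, j, k, ⟨ha, hA⟩, haj, rfl⟩
  obtain ⟨b, hb, hB⟩ := h i
  obtain ⟨t, ht⟩ := (Projectivization.mk_eq_mk_iff' _ _ _ _ _).1 (hA.symm.trans hB)
  have ht' : ∀ j, a j = t * (b j : ℂ) := fun j => (congrFun ht j).symm
  have ht0 : t ≠ 0 := fun h0 => haj (by rw [ht' j, h0, zero_mul])
  rw [ht' j, ht' k, mul_div_mul_left _ _ ht0]
  exact F.div_mem (b k).2 (b j).2

end Automorphisms
/-! ### Triangles -/

section Triangle

variable {ι : Type*} {A : ι → Line}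

theorem fixed_of_linesThrough {τ : ℂ ≃+* ℂ} (hinj : Function.Injective A)
    (hA : ∀ i, conj τ (A i) = A i) {x : Point} (hx : (linesThrough A x).Nontrivial) :
    conj τ x = x := by
  refine point_eq_of_nontrivial hinj hx (fun i hi => ?_) subset_rfl
  rw [mem_linesThrough, ← hA i]
  exact (onLine_conj τ).2 hi

/-- Singular points of `A` are fixed, so a moving point lies on one line of `A` at most. With
`eq_of_fixed` this controls all the incidences on the triangles below. -/
theorem eq_of_not_fixed {τ : ℂ ≃+* ℂ} (hinj : Function.Injective A)
    (hA : ∀ i, conj τ (A i) = A i) {x : Point} (hx : conj τ x ≠ x) {a b : ι}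
    (ha : OnLine x (A a)) (hb : OnLine x (A b)) : a = b := by
  by_contra hab
  exact hx (fixed_of_linesThrough hinj hA ⟨a, ha, b, hb, hab⟩)

/-- Two distinct fixed points would fix the line joining them. An edge that moves thus has its pivot
as only fixed point. -/
theorem eq_of_fixed {τ : ℂ ≃+* ℂ} {L : Line} (hL : conj τ L ≠ L) {x y : Point}
    (hx : conj τ x = x) (hy : conj τ y = y) (hxL : OnLine x L) (hyL : OnLine y L) : x = y := by
  by_contra hxy
  apply hL
  refine line_eq_of_ne hxy ?_ ?_ hxL hyL
  · rw [← hx]; exact (onLine_conj τ).2 hxL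
  · rw [← hy]; exact (onLine_conj τ).2 hyL

/-- An inscribed triangle none of whose edges is fixed by some automorphism is a splitting polygon,
provided that the plinth is not degenerate. -/
theorem IsInscribed.isSplittingPolygon {Ψ : Plinth (sing A) 3} {E : Fin 3 → Line}
    (h : IsInscribed A Ψ E) (hinj : Function.Injective A) {τ : ℂ ≃+* ℂ}
    (hA : ∀ i, conj τ (A i) = A i) (hE : ∀ i, conj τ (E i) ≠ E i)
    (hPS : ∀ i, Ψ.pivot i = Ψ.pivot (i + 1) → Ψ.support (i + 2) ≠ Ψ.support i)
    (hS : ¬ ∀ i, Ψ.support i = Ψ.support 0) (hP : ¬ ∀ i, Ψ.pivot i = Ψ.pivot 0) :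
    IsSplittingPolygon A Ψ E := by
  choose x hx1 hx2 hx3 using h.vertex
  choose p hp hpE using h.pivot
  have hpfix : ∀ i, conj τ (p i) = p i := fun i =>
    fixed_of_linesThrough hinj hA (by rw [hp]; exact Ψ.pivot_nontrivial i)
  -- A fixed vertex would be the pivot of its edge, but it lies on a support line avoiding this
  -- pivot.
  have hxfix : ∀ i, conj τ (x i) ≠ x i := by
    intro i hi
    have h1 := eq_of_fixed (hE i) hi (hpfix i) (hx1 i) (hpE i)
    apply Ψ.support_succ_notMem i
    rw [← hp i, ← h1]
    exact hx3 i
  have hEA : ∀ i a, E i ≠ A a := fun i a h0 => hE i (by rw [h0, hA])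
  have hpivot : ∀ i j, OnLine (p i) (E j) → Ψ.pivot j = Ψ.pivot i := fun i j hij => by
    rw [← hp, ← hp, eq_of_fixed (hE j) (hpfix i) (hpfix j) hij (hpE j)]
  have hcase : ∀ i j : Fin 3, j = i ∨ j = i + 1 ∨ i = j + 1 := by decide
  have h3 : ∀ i : Fin 3, i + 1 + 1 = i + 2 ∧ i + 2 + 1 = i := by decide
  -- If two edges coincide, their pivots agree and the other two vertices both lie on this edge and
  -- on the third. Equal vertices force two support lines to agree, against `hPS`; distinct ones
  -- make all three edges equal, against `hP`.
  have hsucc : ∀ i, E i ≠ E (i + 1) := by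
    intro i hi
    have h1 := hpivot i (i + 1) (hi ▸ hpE i)
    have hx4 := hx1 (i + 1)
    have hx5 := hx2 (i + 1)
    have hx6 := hx3 (i + 1)
    have hx7 := hx1 (i + 2)
    have hx8 := hx2 (i + 2)
    have hx9 := hx3 (i + 2)
    rw [(h3 i).1] at hx5 hx6
    rw [(h3 i).2] at hx8 hx9
    rw [← hi] at hx4
    by_cases hxx : x (i + 1) = x (i + 2)
    · rw [← hxx] at hx9
      exact hPS i h1.symm (eq_of_not_fixed hinj hA (hxfix (i + 1)) hx6 hx9)
    · have h2 := line_eq_of_ne hxx hx4 hx8 hx5 hx7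
      have h4 := hpivot i (i + 2) (h2 ▸ hpE i)
      have h5 : ∀ j, Ψ.pivot j = Ψ.pivot i := by
        intro j
        have : ∀ i j : Fin 3, j = i ∨ j = i + 1 ∨ j = i + 2 := by decide
        rcases this i j with rfl | rfl | rfl
        exacts [rfl, h1, h4]
      exact hP fun j => (h5 j).trans (h5 0).symm
  have hEinj : Function.Injective E := by
    intro i j hij
    rcases hcase i j with h0 | rfl | rfl
    · exact h0.symm
    · exact absurd hij (hsucc i)
    · exact absurd hij.symm (hsucc j)
  refine ⟨h.vertex, h.pivot, ?_, ?_⟩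
  · rintro (a | i) (b | j) hab
    · exact congrArg _ (hinj hab)
    · exact absurd hab.symm (hEA j a)
    · exact absurd hab (hEA i b)
    · exact congrArg _ (hEinj hab)
  have hvert : ∀ k y, OnLine y (E k) → OnLine y (E (k + 1)) →
      linesThrough (addLines A E) y = vertexLines Ψ k := by
    intro k y h1 h2
    obtain rfl := point_eq_of_ne (hsucc k) h1 (hx1 k) h2 (hx2 k)
    -- Concurrent edges would merge the three vertices into one moving point on all the support
    -- lines, which would then coincide, against `hS`.
    have h4 : ¬ OnLine (x k) (E (k + 2)) := by
      intro h4
      have hx4 := hx1 (k + 1)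
      have hx5 := hx2 (k + 1)
      have hx6 := hx3 (k + 1)
      have hx7 := hx1 (k + 2)
      have hx8 := hx2 (k + 2)
      have hx9 := hx3 (k + 2)
      rw [(h3 k).1] at hx5 hx6
      rw [(h3 k).2] at hx8 hx9
      have hs1 := hsucc (k + 1)
      have hs2 := hsucc (k + 2)
      rw [(h3 k).1] at hs1
      rw [(h3 k).2] at hs2
      have e1 := point_eq_of_ne hs1 hx4 (hx2 k) hx5 h4
      have e2 := point_eq_of_ne hs2 hx7 h4 hx8 (hx1 k)
      rw [e1] at hx6
      rw [e2] at hx9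
      have s1 := eq_of_not_fixed hinj hA (hxfix k) hx6 (hx3 k)
      have s2 := eq_of_not_fixed hinj hA (hxfix k) hx9 (hx3 k)
      have h5 : ∀ j, Ψ.support j = Ψ.support (k + 1) := by
        intro j
        have : ∀ i j : Fin 3, j = i ∨ j = i + 1 ∨ j = i + 2 := by decide
        rcases this k j with rfl | rfl | rfl
        exacts [s2, rfl, s1]
      exact hS fun j => (h5 j).trans (h5 0).symm
    ext (a | j)
    · simp only [mem_linesThrough, addLines, Sum.elim_inl, vertexLines, Set.mem_insert_iff,
        Sum.inl.injEq, Set.mem_singleton_iff, reduceCtorEq, or_false]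
      refine ⟨fun ha => eq_of_not_fixed hinj hA (hxfix k) ha (hx3 k), ?_⟩
      rintro rfl
      exact hx3 k
    · simp only [mem_linesThrough, addLines, Sum.elim_inr, vertexLines, Set.mem_insert_iff,
        Sum.inr.injEq, Set.mem_singleton_iff, reduceCtorEq, false_or]
      refine ⟨fun hj => ?_, ?_⟩
      · have : ∀ i j : Fin 3, j = i ∨ j = i + 1 ∨ j = i + 2 := by decide
        rcases this k j with h5 | h5 | rfl
        exacts [Or.inl h5, Or.inr h5, absurd hj h4]
      · rintro (rfl | rfl)
        exacts [h1, h2]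
  intro y i hy
  -- A fixed point of an edge is its pivot. A moving point is a vertex, or else lies on one edge and
  -- at most one line of `A`.
  by_cases hyfix : conj τ y = y
  · left
    obtain rfl := eq_of_fixed (hE i) hyfix (hpfix i) hy (hpE i)
    ext (a | j)
    · simp [addLines, pivotLines, ← hp i]
    · simp only [mem_linesThrough, addLines, Sum.elim_inr, pivotLines, Set.mem_union,
        Set.mem_image, reduceCtorEq, and_false, exists_false, Set.mem_ofPred_eq, Sum.inr.injEq,
        exists_eq_right, false_or]
      refine ⟨hpivot i j, fun hij => ?_⟩
      have : p i = p j := point_eq_of_nontrivial hinj (Ψ.pivot_nontrivial i) (hp i).ge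
        (by rw [hp j, hij])
      rw [this]
      exact hpE j
  · right
    by_cases hk : ∃ k, OnLine y (E k) ∧ OnLine y (E (k + 1))
    · obtain ⟨k, h1, h2⟩ := hk
      exact Or.inl ⟨k, hvert k y h1 h2⟩
    · right
      push Not at hk
      have honly : ∀ j, OnLine y (E j) → j = i := by
        intro j hj
        rcases hcase i j with h0 | rfl | rfl
        · exact h0
        · exact absurd hj (hk i hy)
        · exact absurd hy (hk j hj)
      by_cases ha : ∃ a, OnLine y (A a)
      · obtain ⟨a, ha⟩ := ha
        rw [← Set.encard_pair (show (Sum.inl a : ι ⊕ Fin 3) ≠ Sum.inr i by simp)]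
        apply Set.encard_le_encard
        rintro (b | j) hb
        · exact Or.inl (congrArg _ (eq_of_not_fixed hinj hA hyfix hb ha))
        · exact Or.inr (congrArg _ (honly j hb))
      · push Not at ha
        refine le_trans (b := ({Sum.inr i} : Set (ι ⊕ Fin 3)).encard) ?_ (by
          rw [Set.encard_singleton]; exact one_le_two)
        apply Set.encard_le_encard
        rintro (b | j) hb
        · exact absurd hb (ha b)
        · exact congrArg _ (honly j hb)

variable {K : Type*} [Field K] [Algebra K ℂ]

namespace PlinthCoords

variable {r : ℕ} [NeZero r] {Ψ : Plinth (sing A) r} (c : PlinthCoords K A Ψ) {q : Fin 3 → ℂ}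
  (hq : q ≠ 0) (hs : q ⬝ᵥ c.lineC 0 = 0)

theorem pivotPt_eq (hinj : Function.Injective A) {i j : ℕ}
    (h : Ψ.pivot (Fin.ofNat r i) = Ψ.pivot (Fin.ofNat r j)) : c.pivotPt i = c.pivotPt j :=
  c.eq_pivotPt hinj j ((c.linesThrough_pivotPt i).trans h)

theorem edgeLn_succ_eq {k : ℕ} (h : c.pivotPt (k + 1) = c.pivotPt k) :
    c.edgeLn hq hs (k + 1) = c.edgeLn hq hs k :=
  line_eq_of_ne (c.vertexPt_ne_pivotPt hq hs (k + 1)) (c.vertexPt_edgeLn hq hs (k + 1))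
    (c.pivotPt_edgeLn hq hs (k + 1)) (c.vertexPt_succ_edgeLn hq hs k)
    (h ▸ c.pivotPt_edgeLn hq hs k)

theorem vertexPt_succ_eq {k : ℕ}
    (h : Ψ.support (Fin.ofNat r (k + 1)) = Ψ.support (Fin.ofNat r k)) :
    c.vertexPt hq hs (k + 1) = c.vertexPt hq hs k :=
  point_eq_of_ne (c.edgeLn_ne_support hq hs k) (c.vertexPt_succ_edgeLn hq hs k)
    (c.vertexPt_edgeLn hq hs k) (h ▸ c.vertexPt_support hq hs (k + 1))
    (c.vertexPt_support hq hs k)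

end PlinthCoords

variable {Ψ : Plinth (sing A) 3} (c : PlinthCoords K A Ψ) {q : Fin 3 → ℂ}
  (hq : q ≠ 0) (hs : q ⬝ᵥ c.lineC 0 = 0)

namespace PlinthCoords

/-- For triangles, the degenerate plinths are those for which every walk closes up. -/
theorem closes_of_degenerate (hinj : Function.Injective A)
    (h : (∃ i, Ψ.pivot i = Ψ.pivot (i + 1) ∧ Ψ.support (i + 2) = Ψ.support i) ∨
      (∀ i, Ψ.support i = Ψ.support 0) ∨ ∀ i, Ψ.pivot i = Ψ.pivot 0) :
    OnLine (c.vertexPt hq hs 0) (c.edgeLn hq hs 2) := by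
  have hE0 := c.vertexPt_edgeLn hq hs 0
  have hE2 := c.vertexPt_edgeLn hq hs 2
  rcases h with ⟨i, hP, hS⟩ | h | h
  · have hi : ∀ i : Fin 3, i = 0 ∨ i = 1 ∨ i = 2 := by decide
    rcases hi i with rfl | rfl | rfl
    · have hp : c.pivotPt (0 + 1) = c.pivotPt 0 := c.pivotPt_eq hinj hP.symm
      have h1 := c.edgeLn_succ_eq hq hs hp
      have h2 : c.vertexPt hq hs 2 = c.vertexPt hq hs 0 :=
        point_eq_of_ne (c.edgeLn_ne_support hq hs 0) (h1 ▸ c.vertexPt_succ_edgeLn hq hs 1) hE0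
          (hS ▸ c.vertexPt_support hq hs 2) (c.vertexPt_support hq hs 0)
      rwa [h2] at hE2
    · have hp : c.pivotPt (1 + 1) = c.pivotPt 1 := c.pivotPt_eq hinj hP.symm
      have h1 := c.edgeLn_succ_eq hq hs hp
      have h2 := c.vertexPt_succ_eq hq hs (k := 0) hS.symm
      rw [← h2, h1]
      exact c.vertexPt_edgeLn hq hs 1
    · have hp : c.pivotPt 2 = c.pivotPt 0 := c.pivotPt_eq hinj hP
      have h2 := c.vertexPt_succ_eq hq hs (k := 1) hS.symm
      have h1 : c.edgeLn hq hs 0 = c.edgeLn hq hs 2 :=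
        line_eq_of_ne (c.vertexPt_succ_ne_pivotPt hq hs 0) (c.vertexPt_succ_edgeLn hq hs 0)
          (c.pivotPt_edgeLn hq hs 0) (h2 ▸ hE2) (hp ▸ c.pivotPt_edgeLn hq hs 2)
      rwa [h1] at hE0
  · have h1 := c.vertexPt_succ_eq hq hs (k := 0) (h 1)
    have h2 := c.vertexPt_succ_eq hq hs (k := 1) ((h 2).trans (h 1).symm)
    rw [← h1, ← h2]
    exact hE2
  · have h1 := c.edgeLn_succ_eq hq hs (k := 0) (c.pivotPt_eq hinj (h 1))
    have h2 := c.edgeLn_succ_eq hq hs (k := 1) (c.pivotPt_eq hinj ((h 2).trans (h 1).symm))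
    rw [h2, h1]
    exact hE0

/-- The two triangles of an irreducible `Δ` are splitting polygons. -/
theorem isSplittingPolygon_triangle (hinj : Function.Injective A)
    (hA : ∀ (τ : ℂ ≃ₐ[K] ℂ) i, conj τ.toRingEquiv (A i) = A i)
    (hd : c.delta.natDegree = 2) (hirr : Irreducible c.delta) {μ μ' : ℂ} (hne : μ ≠ μ')
    (hμ : Polynomial.aeval μ c.delta = 0) (hμ' : Polynomial.aeval μ' c.delta = 0) :
    IsSplittingPolygon A Ψ (c.polygon μ) := by
  obtain ⟨τ, hτ⟩ := exists_algEquiv_of_irreducible hirr hμ hμ'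
  -- A degenerate plinth would close even the walk starting at `v`, contradicting degree two.
  have hnd := mt (c.closes_of_degenerate c.v_ne_zero c.v_dot hinj) fun h =>
    c.closingC_v_ne_zero hd ((c.closingC_eq_zero_iff c.v_ne_zero c.v_dot).2 h)
  push Not at hnd
  refine (c.isInscribed hμ).isSplittingPolygon hinj (hA τ) (fun i h => ?_) hnd.1
    (by push Not; exact hnd.2.1) (by push Not; exact hnd.2.2)
  rw [c.conj_polygon, hτ] at h
  exact hne (c.polygon_injective i h).symm

end PlinthCoords

end Triangle
/-! ### Quadratic polynomials -/

section Quadratic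

variable {K Ω : Type*} [Field K] [Field Ω] [Algebra K Ω]

/-- Vieta's formula, by subtracting the two equations and cancelling `x - y`. It shows both that
there is no third root and that each root lies in the field generated by the other. -/
theorem add_eq_of_roots {f : K[X]} (hf : f.natDegree = 2) {x y : Ω} (hxy : x ≠ y)
    (hx : Polynomial.aeval x f = 0) (hy : Polynomial.aeval y f = 0) :
    x + y = algebraMap K Ω (-f.coeff 1 / f.coeff 2) := by
  have h2 : f.coeff 2 ≠ 0 := by
    rw [← hf]
    exact Polynomial.leadingCoeff_ne_zero.2 (by rintro rfl; simp at hf)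
  have h2' : algebraMap K Ω (f.coeff 2) ≠ 0 := by simpa using h2
  rw [Polynomial.aeval_eq_sum_range, hf] at hx hy
  simp only [Finset.sum_range_succ, Finset.sum_range_zero, Algebra.smul_def] at hx hy
  rw [map_div₀, map_neg, eq_div_iff h2']
  apply mul_left_cancel₀ (sub_ne_zero.2 hxy)
  linear_combination hx - hy

theorem eq_or_eq_of_root {f : K[X]} (hf : f.natDegree = 2) {x y : Ω} (hxy : x ≠ y)
    (hx : Polynomial.aeval x f = 0) (hy : Polynomial.aeval y f = 0) (z : Ω)
    (hz : Polynomial.aeval z f = 0) : z = x ∨ z = y := by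
  by_contra! h
  apply h.2
  have h1 := add_eq_of_roots hf hxy hx hy
  have h2 := add_eq_of_roots hf h.1.symm hx hz
  exact add_left_cancel (h2.trans h1.symm)

theorem mem_range_of_linear {g : K[X]} (hg : g.natDegree = 1) {x : Ω}
    (hx : Polynomial.aeval x g = 0) : x ∈ Set.range (algebraMap K Ω) := by
  have h1 : g.coeff 1 ≠ 0 := by
    rw [← hg]
    exact Polynomial.leadingCoeff_ne_zero.2 (by rintro rfl; simp at hg)
  have h1' : algebraMap K Ω (g.coeff 1) ≠ 0 := by simpa using h1
  rw [Polynomial.aeval_eq_sum_range, hg] at hx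
  simp only [Finset.sum_range_succ, Finset.sum_range_zero, Algebra.smul_def] at hx
  refine ⟨-g.coeff 0 / g.coeff 1, ?_⟩
  rw [map_div₀, map_neg, div_eq_iff h1']
  linear_combination -hx

theorem IsReducible.natDegree_eq {f : K[X]} (hf : IsReducible f) (h2 : f.natDegree ≤ 2) :
    f.natDegree = 2 := by
  obtain ⟨h0, g, h, hg, hh, rfl⟩ := hf
  rw [Polynomial.natDegree_mul (left_ne_zero_of_mul h0) (right_ne_zero_of_mul h0)] at h2 ⊢
  omega

theorem IsReducible.mem_range {f : K[X]} (hf : IsReducible f) (h2 : f.natDegree ≤ 2) {x : Ω}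
    (hx : Polynomial.aeval x f = 0) : x ∈ Set.range (algebraMap K Ω) := by
  obtain ⟨h0, g, h, hg, hh, rfl⟩ := hf
  rw [Polynomial.natDegree_mul (left_ne_zero_of_mul h0) (right_ne_zero_of_mul h0)] at h2
  rw [map_mul, mul_eq_zero] at hx
  rcases hx with hx | hx
  · exact mem_range_of_linear (by omega) hx
  · exact mem_range_of_linear (by omega) hx

end Quadratic

/-! ### Definition fields of the completed arrangements -/

section DefField

variable {ι : Type*} {r : ℕ} [NeZero r] {K : Type*} [Field K] [Algebra K ℂ] {A : ι → Line}
  {Ψ : Plinth (sing A) r} (c : PlinthCoords K A Ψ)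

theorem IsCoord.cross_eq_zero {F : Type*} [Field F] [Algebra F ℂ] {a b : Fin 3 → F}
    {L : ℙ ℂ (Fin 3 → ℂ)} (ha : IsCoord a L) (hb : IsCoord b L) : crossProduct a b = 0 := by
  obtain ⟨ha, hA⟩ := ha
  obtain ⟨hb, hB⟩ := hb
  have h := (mk_eq_mk_iff_cross ha hb).1 (hA.symm.trans hB)
  have h2 : crossProduct (toC a) (toC b) = toC (crossProduct a b) :=
    cross_map (algebraMap F ℂ) a b
  funext j
  exact (map_eq_zero (algebraMap F ℂ)).1 (congrFun (h2.symm.trans h) j)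

theorem IsCoord.div_eq {F F' : Type*} [Field F] [Algebra F ℂ] [Field F'] [Algebra F' ℂ]
    {a : Fin 3 → F} {b : Fin 3 → F'} {L : ℙ ℂ (Fin 3 → ℂ)} (ha : IsCoord a L) (hb : IsCoord b L)
    (j k : Fin 3) : toC a k / toC a j = toC b k / toC b j := by
  obtain ⟨ha, hA⟩ := ha
  obtain ⟨hb, hB⟩ := hb
  obtain ⟨t, ht⟩ := (Projectivization.mk_eq_mk_iff' _ _ _ _ _).1 (hA.symm.trans hB)
  have ht0 : t ≠ 0 := fun h0 => ha (by rw [← ht, h0, zero_smul])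
  rw [← ht, Pi.smul_apply, Pi.smul_apply, smul_eq_mul, smul_eq_mul, mul_div_mul_left _ _ ht0]

theorem PlinthCoords.exists_isCoord_polygon {F : IntermediateField ℚ ℂ}
    (hK : ∀ x, algebraMap K ℂ x ∈ F) {lam : ℂ} (hlam : lam ∈ F) (i : Fin r) :
    ∃ a : Fin 3 → F, IsCoord a (c.polygon lam i) := by
  let a := edgeVec (fun k j => (⟨algebraMap K ℂ (c.s (Fin.ofNat r k) j), hK _⟩ : F))
    (fun k j => (⟨algebraMap K ℂ (c.p (Fin.ofNat r k) j), hK _⟩ : F))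
    (fun j => (⟨algebraMap K ℂ (c.u j) + lam * algebraMap K ℂ (c.v j),
      add_mem (hK _) (mul_mem hlam (hK _))⟩ : F)) i
  have ha : toC a = c.edge lam i := (edgeVec_map (algebraMap F ℂ) _ _ _ _).symm
  refine ⟨a, ha ▸ c.edge_ne_zero lam i, ?_⟩
  rw [PlinthCoords.polygon]
  congr 1
  exact ha.symm

/-- The parameter of a polygon is defined over the definition field. -/
theorem PlinthCoords.mem_of_isCoord_polygon {F : IntermediateField ℚ ℂ}
    (hK : ∀ x, algebraMap K ℂ x ∈ F) {lam : ℂ} {a : Fin 3 → F}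
    (ha : IsCoord a (c.polygon lam 0)) : lam ∈ F := by
  obtain ⟨ha, hA⟩ := ha
  have h1 := c.vertexPt_edgeLn (c.start_ne_zero lam) (c.start_dot lam) 0
  have h2 : c.polygon lam 0 = c.edgeLn (c.start_ne_zero lam) (c.start_dot lam) 0 :=
    c.polygon_eq lam 0 (NeZero.pos r)
  rw [← h2, hA] at h1
  have h3 : (toC c.u + lam • toC c.v) ⬝ᵥ toC a = 0 := (onLine_mk _ _).1 h1
  rw [add_dotProduct, smul_dotProduct, smul_eq_mul] at h3
  -- If `v` were on the first edge, so would `u` be, and the edge would be the support line `S_1`.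
  -- Hence `λ` is a quotient of two elements of `F`.
  have hv : toC c.v ⬝ᵥ toC a ≠ 0 := by
    intro hv
    rw [hv, mul_zero, add_zero] at h3
    have e1 := (mk_eq_mk_iff_cross ha c.toC_linearIndependent).2 (cross_cross_of_dot h3 hv)
    have e2 := (mk_eq_mk_iff_cross (c.lineC_ne_zero 0) c.toC_linearIndependent).2
      (cross_cross_of_dot c.u_dot c.v_dot)
    apply c.edgeLn_ne_support (c.start_ne_zero lam) (c.start_dot lam) 0
    rw [← h2, hA, c.line_eq, e1, e2]
  have hmem : ∀ b : Fin 3 → K, toC b ⬝ᵥ toC a ∈ F := fun b => by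
    simp only [dotProduct, toC]
    exact sum_mem fun j _ => mul_mem (hK _) (a j).2
  have : lam = -(toC c.u ⬝ᵥ toC a) / (toC c.v ⬝ᵥ toC a) := by
    rw [eq_div_iff hv]
    linear_combination h3
  rw [this]
  exact F.div_mem (F.neg_mem (hmem _)) (hmem _)

theorem defField_le_addLines (A : ι → Line) {κ : Type*} (E : κ → Line) :
    defField A ≤ defField (Sum.elim A E : ι ⊕ κ → Line) := by
  apply IntermediateField.adjoin.mono
  rintro z ⟨i, a, j, k, h⟩
  exact ⟨Sum.inl i, a, j, k, h⟩

theorem PlinthCoords.defField_addLines_le {F : IntermediateField ℚ ℂ}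
    (hK : ∀ x, algebraMap K ℂ x ∈ F) (hA : defField A ≤ F) {lam : ℂ} (hlam : lam ∈ F) :
    defField (addLines A (c.polygon lam)) ≤ F := by
  apply defField_le
  rintro (i | i)
  · exact exists_isCoord_defField A i F hA
  · exact c.exists_isCoord_polygon hK hlam i

/-- The definition field of `A ∪ E^μ` is obtained by adjoining `μ`. -/
theorem PlinthCoords.defField_addLines {Ψ : Plinth (sing A) r}
    (c : PlinthCoords (defField A) A Ψ) (lam : ℂ) :
    defField (addLines A (c.polygon lam)) =
      (IntermediateField.adjoin (defField A) {lam}).restrictScalars ℚ := by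
  have hle : defField A ≤ defField (addLines A (c.polygon lam)) := defField_le_addLines A _
  apply le_antisymm
  · refine c.defField_addLines_le (fun x => ?_) (fun x hx => ?_) ?_
    · exact (IntermediateField.adjoin (defField A) {lam}).algebraMap_mem x
    · exact (IntermediateField.adjoin (defField A) {lam}).algebraMap_mem ⟨x, hx⟩
    · exact IntermediateField.mem_adjoin_simple_self (defField A) lam
  · have hlam : lam ∈ defField (addLines A (c.polygon lam)) := by
      obtain ⟨a, ha⟩ := exists_isCoord_defField (addLines A (c.polygon lam)) (Sum.inr 0) _ le_rfl
      exact c.mem_of_isCoord_polygon (fun x => hle x.2) ha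
    have h1 : IntermediateField.adjoin (defField A) {lam} ≤
        IntermediateField.extendScalars hle := by
      rw [IntermediateField.adjoin_simple_le_iff]
      exact hlam
    exact fun x hx => h1 hx

theorem relfinrank_adjoin {F : IntermediateField ℚ ℂ} {f : F[X]} (hf : Irreducible f)
    (hd : f.natDegree = 2) {x : ℂ} (hx : Polynomial.aeval x f = 0) :
    IntermediateField.relfinrank F ((IntermediateField.adjoin F {x}).restrictScalars ℚ) = 2 := by
  have hle : F ≤ (IntermediateField.adjoin F {x}).restrictScalars ℚ := fun y hy =>
    (IntermediateField.adjoin F {x}).algebraMap_mem ⟨y, hy⟩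
  rw [IntermediateField.relfinrank_eq_finrank_of_le hle]
  have h1 : IntermediateField.extendScalars hle = IntermediateField.adjoin F {x} := by
    ext; rfl
  rw [h1, IntermediateField.adjoin.finrank (IsAlgebraic.isIntegral ⟨f, hf.ne_zero, hx⟩),
    ← minpoly.eq_of_irreducible hf hx, Polynomial.natDegree_mul_C (by simpa using hf.ne_zero), hd]

theorem adjoin_root_eq {F : IntermediateField ℚ ℂ} {f : F[X]} (hd : f.natDegree = 2) {x y : ℂ}
    (hxy : x ≠ y) (hx : Polynomial.aeval x f = 0) (hy : Polynomial.aeval y f = 0) :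
    IntermediateField.adjoin F {x} = IntermediateField.adjoin F {y} := by
  have key : ∀ x y : ℂ, x ≠ y → Polynomial.aeval x f = 0 → Polynomial.aeval y f = 0 →
      IntermediateField.adjoin F {x} ≤ IntermediateField.adjoin F {y} := by
    intro x y hxy hx hy
    rw [IntermediateField.adjoin_simple_le_iff]
    rw [eq_sub_of_add_eq (add_eq_of_roots hd hxy hx hy)]
    exact sub_mem (IntermediateField.algebraMap_mem _ _) (IntermediateField.mem_adjoin_simple_self _ _)
  exact le_antisymm (key x y hxy hx hy) (key y x hxy.symm hy hx)

theorem numberField_adjoin {F : IntermediateField ℚ ℂ} [NumberField F] {x : ℂ}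
    (hx : IsAlgebraic F x) :
    NumberField ((IntermediateField.adjoin F {x}).restrictScalars ℚ) := by
  have h1 : FiniteDimensional F (IntermediateField.adjoin F {x}) :=
    IntermediateField.adjoin.finiteDimensional hx.isIntegral
  have h2 : FiniteDimensional ℚ (IntermediateField.adjoin F {x}) :=
    Module.Finite.trans F _
  exact { to_charZero := inferInstance, to_finiteDimensional := h2 }

theorem conj_eq_of_defField (A : ι → Line) (τ : ℂ ≃ₐ[defField A] ℂ) (i : ι) :
    conj τ.toRingEquiv (A i) = A i := by
  obtain ⟨a, ha, h⟩ := exists_isCoord_defField A i _ le_rfl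
  rw [h]
  exact conj_mk_algebraMap τ ha

/-- The completions by the polygons of the two roots of an irreducible `Δ` are conjugate. -/
theorem PlinthCoords.galoisConjugate {Ψ : Plinth (sing A) r} [NumberField (defField A)]
    (c : PlinthCoords (defField A) A Ψ) (hd : c.delta.natDegree = 2)
    (hirr : Irreducible c.delta) {μ μ' : ℂ} (hne : μ ≠ μ')
    (hμ : Polynomial.aeval μ c.delta = 0) (hμ' : Polynomial.aeval μ' c.delta = 0) :
    GaloisConjugate (addLines A (c.polygon μ)) (addLines A (c.polygon μ')) := by
  obtain ⟨τ, hτ⟩ := exists_algEquiv_of_irreducible hirr hμ hμ'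
  let L := IntermediateField.adjoin (defField A) {μ}
  have hL : IntermediateField.adjoin (defField A) {μ'} = L := (adjoin_root_eq hd hne hμ hμ').symm
  -- The quadratic field is generated by either root, so `τ` restricts to an automorphism of it.
  have hmap : L.map τ.toAlgHom = L := by
    rw [IntermediateField.adjoin_map, Set.image_singleton]
    exact (congrArg (fun x => IntermediateField.adjoin (defField A) {x}) hτ).trans hL
  let σ : L ≃ₐ[defField A] L :=
    (IntermediateField.intermediateFieldMap τ L).trans (IntermediateField.equivOfEq hmap)
  have hσ : ∀ x : L, ((σ x : L) : ℂ) = τ x := fun x => rfl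
  have hF := c.defField_addLines μ
  refine ⟨L.restrictScalars ℚ, numberField_adjoin ⟨_, hirr.ne_zero, hμ⟩, hF.le,
    (c.defField_addLines μ').le.trans (by rw [hL]), σ.restrictScalars ℚ, fun i => ?_⟩
  obtain ⟨a, ha⟩ := exists_isCoord_defField (addLines A (c.polygon μ)) i
    (L.restrictScalars ℚ) hF.le
  refine ⟨a, ha, ?_⟩
  have hconj : conj τ.toRingEquiv (addLines A (c.polygon μ) i) = addLines A (c.polygon μ') i := by
    rcases i with i | i
    · exact conj_eq_of_defField A τ i
    · rw [← hτ]
      exact c.conj_polygon τ μ i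
  obtain ⟨ha0, ha⟩ := ha
  rw [ha, conj_mk] at hconj
  exact ⟨conj_ne_zero τ.toRingEquiv ha0, hconj.symm⟩

/-- Conjugate completions of `A` defined over the definition field of `A` are equal. -/
theorem eq_of_galoisConjugate {κ : Type*} {A : ι → Line} {E E' : κ → Line}
    (hE : defField (Sum.elim A E : ι ⊕ κ → Line) = defField A)
    (h : GaloisConjugate (Sum.elim A E : ι ⊕ κ → Line) (Sum.elim A E' : ι ⊕ κ → Line)) :
    E = E' := by
  obtain ⟨F, -, hF, -, σ, hσ⟩ := h
  rw [hE] at hF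
  -- Both arrangements contain `A`, so `σ` preserves the coefficient ratios of each line of `A`, and
  -- these generate the definition field.
  have hfix : ∀ x : defField A, (σ (IntermediateField.inclusion hF x) : ℂ) = x := by
    let φ : defField A →ₐ[ℚ] ℂ := F.val.comp (σ.toAlgHom.comp (IntermediateField.inclusion hF))
    have : φ = (defField A).val := by
      refine IntermediateField.algHom_ext_of_eq_adjoin ℚ (S := defField A) rfl ?_
      rintro z hz
      obtain ⟨i, a, j, k, ha, haj, rfl⟩ := id hz
      obtain ⟨b, hb, hb'⟩ := hσ (Sum.inl i)
      have h1 := ha.div_eq hb j k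
      have h2 := ha.div_eq hb' j k
      have h3 : IntermediateField.inclusion hF ⟨a k / a j, IntermediateField.subset_adjoin _ _ hz⟩
          = b k / b j := Subtype.ext h1
      change ((σ (IntermediateField.inclusion hF ⟨a k / a j,
        IntermediateField.subset_adjoin _ _ hz⟩) : F) : ℂ) = a k / a j
      rw [h3, map_div₀]
      exact h2.symm
    exact fun x => DFunLike.congr_fun this x
  funext i
  obtain ⟨e, he⟩ := exists_isCoord_defField (Sum.elim A E : ι ⊕ κ → Line) (Sum.inr i) _ hE.le
  obtain ⟨a, ha, ha'⟩ := hσ (Sum.inr i)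
  let e' : Fin 3 → F := fun j => IntermediateField.inclusion hF (e j)
  have he' : IsCoord e' (E i) := he
  -- The line `E i` has coordinates in the field fixed by `σ`, so its conjugate `E' i` is the same
  -- line.
  have hσe : (fun j => σ (e' j)) = e' := funext fun j => Subtype.ext (hfix (e j))
  have h1 := ha.cross_eq_zero he'
  have h2 := cross_map (σ : F →+* F) a e'
  rw [h1] at h2
  have h3 : crossProduct (fun j => σ (a j)) e' = 0 := by
    rw [← hσe]
    refine h2.trans ?_
    funext j
    exact map_zero σ
  obtain ⟨ha0, hA⟩ := ha'
  obtain ⟨he0, hE⟩ := he'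
  have hA' : E' i = Projectivization.mk ℂ _ ha0 := hA
  rw [hA', hE, mk_eq_mk_iff_cross]
  have h4 : crossProduct (toC (fun j => σ (a j))) (toC e') = 0 := by
    have := cross_map (algebraMap F ℂ) (fun j => σ (a j)) e'
    rw [h3] at this
    refine this.trans ?_
    funext j
    exact map_zero _
  rw [← cross_anticomm, h4, neg_zero]

end DefField

/-! ### Splitting polygons and pairs obtained from irreducible and reducible `Δ`. -/

section Completion

variable {ι : Type*} {r : ℕ} [NeZero r] {A : ι → Line} {Ψ : Plinth (sing A) r}

/-- If `Δ` is irreducible, then the polygon of one root is a splitting polygon as soon as the other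
one is. -/
theorem PlinthCoords.isSplittingPolygon_of_root (c : PlinthCoords (defField A) A Ψ)
    (hirr : Irreducible c.delta) {μ μ' : ℂ} (hμ : Polynomial.aeval μ c.delta = 0)
    (hμ' : Polynomial.aeval μ' c.delta = 0) (h : IsSplittingPolygon A Ψ (c.polygon μ)) :
    IsSplittingPolygon A Ψ (c.polygon μ') := by
  obtain ⟨τ, hτ⟩ := exists_algEquiv_of_irreducible hirr hμ hμ'
  have h1 := h.conj (τ := τ.toRingEquiv) (conj_eq_of_defField A τ)
  simp only [c.conj_polygon, hτ] at h1
  exact h1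

theorem PlinthCoords.isSplittingPolygon_of_irreducible (c : PlinthCoords (defField A) A Ψ)
    (hinj : Function.Injective A) (hd : c.delta.natDegree = 2) (hirr : Irreducible c.delta)
    {μ : Fin 2 → ℂ} (hμ : Function.Injective μ) (hroot : ∀ i, Polynomial.aeval (μ i) c.delta = 0)
    (h4 : 4 ≤ r → ∃ i, IsSplittingPolygon A Ψ (c.polygon (μ i))) (i : Fin 2) :
    IsSplittingPolygon A Ψ (c.polygon (μ i)) := by
  obtain ⟨j, hj⟩ : ∃ j, IsSplittingPolygon A Ψ (c.polygon (μ j)) := by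
    -- A splitting polygon is assumed to exist for `r ≥ 4` only; for triangles it comes from the
    -- Galois argument.
    rcases Ψ.three_le.lt_or_eq with h | h
    · exact h4 h
    · subst h
      exact ⟨0, c.isSplittingPolygon_triangle hinj (conj_eq_of_defField A) hd hirr
        (hμ.ne (by decide : (0 : Fin 2) ≠ 1)) (hroot 0) (hroot 1)⟩
  exact c.isSplittingPolygon_of_root hirr (hroot j) (hroot i) hj

/-- The pair obtained from the two roots of a reducible `Δ`. -/
theorem PlinthCoords.isPair_of_isReducible {K : Type*} [Field K] [Algebra K ℂ]
    (c : PlinthCoords K A Ψ) (hA : IsRigid A) (hred : IsReducible c.delta) {ν : Fin 2 → ℂ}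
    (hν : Function.Injective ν) (hroot : ∀ j, Polynomial.aeval (ν j) c.delta = 0)
    (hsplit : ∀ j, IsSplittingPolygon A Ψ (c.polygon (ν j))) :
    IsPair (addLines A (c.polygon (ν 0))) (addLines A (c.polygon (ν 1))) := by
  have hd := hred.natDegree_eq c.natDegree_delta_le
  have hne := hν.ne (by decide : (0 : Fin 2) ≠ 1)
  exact (c.isRigid_and_isPair hA hd hne (eq_or_eq_of_root hd hne (hroot 0) (hroot 1))
    (hsplit 0) (hsplit 1)).2.2

/-- A reducible `Δ` over the definition field yields nonarithmetic pairs. -/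
theorem PlinthCoords.isNonarithmeticPair [NumberField (defField A)]
    (c : PlinthCoords (defField A) A Ψ) (hA : IsRigid A) (hred : IsReducible c.delta)
    {ν : Fin 2 → ℂ} (hν : Function.Injective ν)
    (hroot : ∀ j, Polynomial.aeval (ν j) c.delta = 0)
    (hsplit : ∀ j, IsSplittingPolygon A Ψ (c.polygon (ν j))) :
    IsNonarithmeticPair (addLines A (c.polygon (ν 0))) (addLines A (c.polygon (ν 1))) ∧
      ∀ j, defField (addLines A (c.polygon (ν j))) = defField A := by
  have hfield : ∀ j, defField (addLines A (c.polygon (ν j))) = defField A := by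
    intro j
    obtain ⟨x, hx⟩ := hred.mem_range c.natDegree_delta_le (hroot j)
    exact le_antisymm (c.defField_addLines_le (fun y => y.2) le_rfl (hx ▸ x.2))
      (defField_le_addLines A _)
  refine ⟨⟨c.isPair_of_isReducible hA hred hν hroot hsplit, ?_, ?_, fun hconj => ?_⟩, hfield⟩
  · rw [hfield]; infer_instance
  · rw [hfield]; infer_instance
  · have h1 := eq_of_galoisConjugate (hfield 0) hconj
    exact hν.ne (by decide : (0 : Fin 2) ≠ 1) (c.polygon_injective 0 (congrFun h1 0))

end Completion
end LineArr

theorem mainTheorem4 :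
    -- nonarithmetic pairs over a number field
    (∀ {ι : Type*} [Finite ι] (A : ι → Line), IsRigid A → NumberField (defField A) →
      ∀ {r₁ : ℕ} [NeZero r₁] (Ψ₁ : Plinth (sing A) r₁) (c₁ : PlinthCoords (defField A) A Ψ₁),
      c₁.delta.natDegree = 2 → Irreducible c₁.delta →
      ∀ μ : Fin 2 → ℂ, Function.Injective μ → (∀ i, Polynomial.aeval (μ i) c₁.delta = 0) →
      (4 ≤ r₁ → ∃ i, IsSplittingPolygon A Ψ₁ (c₁.polygon (μ i))) →
      -- the arithmetic pair
      (∀ i, IsSplittingPolygon A Ψ₁ (c₁.polygon (μ i))) ∧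
      IsArithmeticPair (addLines A (c₁.polygon (μ 0))) (addLines A (c₁.polygon (μ 1))) ∧
      (∀ i, IsRigid (addLines A (c₁.polygon (μ i)))) ∧
      defField (addLines A (c₁.polygon (μ 0))) = defField (addLines A (c₁.polygon (μ 1))) ∧
      (∀ i, defField A ≤ defField (addLines A (c₁.polygon (μ i))) ∧
        IntermediateField.relfinrank (defField A)
          (defField (addLines A (c₁.polygon (μ i)))) = 2) ∧
      -- the nonarithmetic pair
      ∀ (i : Fin 2) {r₂ : ℕ} [NeZero r₂]
        (Ψ₂ : Plinth (sing (addLines A (c₁.polygon (μ i)))) r₂)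
        (c₂ : PlinthCoords (defField (addLines A (c₁.polygon (μ i))))
          (addLines A (c₁.polygon (μ i))) Ψ₂),
        IsReducible c₂.delta →
        ∀ ν : Fin 2 → ℂ, Function.Injective ν → (∀ j, Polynomial.aeval (ν j) c₂.delta = 0) →
        (∀ j, IsSplittingPolygon (addLines A (c₁.polygon (μ i))) Ψ₂ (c₂.polygon (ν j))) →
        IsNonarithmeticPair
            (addLines (addLines A (c₁.polygon (μ i))) (c₂.polygon (ν 0)))
            (addLines (addLines A (c₁.polygon (μ i))) (c₂.polygon (ν 1))) ∧
          ∀ j, defField (addLines (addLines A (c₁.polygon (μ i))) (c₂.polygon (ν j))) =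
            defField (addLines A (c₁.polygon (μ i)))) ∧
    -- rational pairs
    (∀ {ι : Type*} [Finite ι] (A : ι → Line), IsRigid A → defField A = ⊥ →
      ∀ {r : ℕ} [NeZero r] (Ψ : Plinth (sing A) r) (c : PlinthCoords ℚ A Ψ),
      IsReducible c.delta →
      ∀ ν : Fin 2 → ℂ, Function.Injective ν → (∀ j, Polynomial.aeval (ν j) c.delta = 0) →
      (∀ j, IsSplittingPolygon A Ψ (c.polygon (ν j))) →
      IsRationalPair (addLines A (c.polygon (ν 0))) (addLines A (c.polygon (ν 1)))) := by
  refine ⟨?_, ?_⟩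
  · intro ι _ A hA hN r₁ _ Ψ₁ c₁ hd hirr μ hμ hroot h4
    have hne := hμ.ne (by decide : (0 : Fin 2) ≠ 1)
    have hroots := eq_or_eq_of_root hd hne (hroot 0) (hroot 1)
    have hsplit := c₁.isSplittingPolygon_of_irreducible hA.injective hd hirr hμ hroot h4
    obtain ⟨hr0, hr1, hpair⟩ := c₁.isRigid_and_isPair hA hd hne hroots (hsplit 0) (hsplit 1)
    have hrigid : ∀ i, IsRigid (addLines A (c₁.polygon (μ i))) := Fin.forall_fin_two.2 ⟨hr0, hr1⟩
    refine ⟨hsplit, ⟨hpair, c₁.galoisConjugate hd hirr hne (hroot 0) (hroot 1)⟩, hrigid, ?_,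
      fun i => ⟨defField_le_addLines A _, ?_⟩, ?_⟩
    · rw [c₁.defField_addLines, c₁.defField_addLines, adjoin_root_eq hd hne (hroot 0) (hroot 1)]
    · rw [c₁.defField_addLines]
      exact relfinrank_adjoin hirr hd (hroot i)
    · intro i r₂ _ Ψ₂ c₂ hred ν hν hνroot hνsplit
      -- The first completion is rigid over a number field, so it can serve as base arrangement for
      -- the second plinth.
      have : NumberField (defField (addLines A (c₁.polygon (μ i)))) := by
        rw [c₁.defField_addLines]
        exact numberField_adjoin ⟨_, hirr.ne_zero, hroot i⟩
      exact c₂.isNonarithmeticPair (hrigid i) hred hν hνroot hνsplit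
  · intro ι _ A hA hQ r _ Ψ c hred ν hν hroot hsplit
    have hfield : ∀ j, defField (addLines A (c.polygon (ν j))) = ⊥ := by
      intro j
      obtain ⟨x, hx⟩ := hred.mem_range c.natDegree_delta_le (hroot j)
      exact le_bot_iff.1 (c.defField_addLines_le
        (fun y => (⊥ : IntermediateField ℚ ℂ).algebraMap_mem y) hQ.le
        (hx ▸ (⊥ : IntermediateField ℚ ℂ).algebraMap_mem x))
    exact ⟨c.isPair_of_isReducible hA hred hν hroot hsplit, hfield 0, hfield 1⟩
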